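/- Let $G$ be the helix-3-graph: its vertex set is $\mathbb Z$ and its edges are $z_m=\{m-1,m\}$ (the rungs) and $h_m=\{m-3,m\}$, $m\in\mathbb Z$. Let $\mathbf P$ be the uniform spanning tree measure on $G$, that is, the limit as $n\to\infty$ of the uniform distributions on the spanning trees of the finite subgraphs of $G$ induced on $\{-n,\dots,n\}$ (convergence of the probabilities of all events depending on finitely many edges; this limit exists and is a unique probability measure on sets of edges). Let $T$ be the random edge set with distribution $\mathbf P$ and let $X_m=\mathbf 1_T(z_m)$, $m\in\mathbb Z$. Let $\gamma=\frac{1+\sqrt5}{2}$. (i) $X$ is a determinantal point process with real symmetric Toeplitz matrix $A_{k,l}=\hat f(l-k)$, that is, for every finite $S\subset\mathbb Z$, $$\mathbf P[X_s=1\text{ for all }s\in S]=\det\big((\hat f(l-k))_{k,l\in S}\big),$$ where $$\hat f(m)=\eta\,\alpha^{|m|}+\bar\eta\,\bar\alpha^{|m|},\qquad m\in\mathbb Z,$$ $$\eta=\frac{\gamma^{3/2}}{4\sqrt5}+i\,\frac{\gamma^{-3/2}}{4\sqrt5},\qquad \alpha=\frac{\gamma^{-3/2}-1}{2}+i\,\frac{\gamma^{3/2}-1}{2}.$$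 (ii) The Fourier transform $f$ of $\hat f$ equals $$f(x)=\frac{1}{4+4\cos(2\pi x)+2\cos(4\pi x)},\qquad x\in[0,1];$$ that is, $f$ is a measurable function from $[0,1]$ to $[0,1]$ with $\hat f(k)=\int_0^1 f(x)\,e^{-2\pi i kx}\,dx$ for all $k\in\mathbb Z$ and $f(x)=\sum_{k\in\mathbb Z}\hat f(k)\,e^{2\pi i kx}$ for all $x\in[0,1]$. -/

import Mathlib

open MeasureTheory ProbabilityTheory Filter Topology

noncomputable section

/-- The rung `z_m = {m - 1, m}`, an unordered pair of integers. -/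
def rung (m : ℤ) : Sym2 ℤ := s(m - 1, m)

/-- The edge `h_m = {m - k, m}`. -/
def longEdge (k : ℕ) (m : ℤ) : Sym2 ℤ := s(m - k, m)

/-- The helix-`k`-graph (for `k ≥ 2`): its vertices are the integers and its edges are
`z_m = {m - 1, m}` and `h_m = {m - k, m}`, for all integers `m`. -/
def helixGraph (k : ℕ) : SimpleGraph ℤ :=
  SimpleGraph.fromEdgeSet {e | ∃ m : ℤ, e = rung m ∨ e = longEdge k m}

/-- The spanning trees of the subgraph of `G` induced on the vertex set `W`, each one regarded as a
set of edges: sets `t` of edges of `G` with both ends in `W` such that `(W, t)` is a tree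
(connected and without cycles). -/
def spanningTrees {V : Type*} (G : SimpleGraph V) (W : Set V) : Set (Set (Sym2 V)) :=
  {t | t ⊆ G.edgeSet ∧ (∀ e ∈ t, ∀ v ∈ e, v ∈ W) ∧
    ((SimpleGraph.fromEdgeSet t).induce W).IsTree}

/-- `P` is the uniform spanning tree measure of `G` along the exhaustion `W`: a probability measure
on sets of edges (with the product sigma-algebra), the limit as `n → ∞` of the uniform
distributions on the spanning trees of the finite subgraphs of `G` induced on `W n`. The limit is
that of weak convergence for the product topology: the probability of every event that prescribes
the random edge set on finitely many pairs of vertices converges. -/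
def IsUniformSpanningTreeMeasure {V : Type*} (G : SimpleGraph V) (W : ℕ → Set V)
    (P : Measure (Set (Sym2 V))) : Prop :=
  IsProbabilityMeasure P ∧
    ∀ (F : Finset (Sym2 V)) (B : Set (Sym2 V)),
      Tendsto
        (fun n : ℕ => uniformOn (spanningTrees G (W n)) {T | ∀ e ∈ F, (e ∈ T ↔ e ∈ B)})
        atTop (𝓝 (P {T | ∀ e ∈ F, (e ∈ T ↔ e ∈ B)}))

/-- `P` is the uniform spanning tree measure on the helix-`k`-graph, the limit of the uniform
distributions on the spanning trees of the subgraphs induced on `{-n, …, n}`. -/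
def IsHelixUST (k : ℕ) (P : Measure (Set (Sym2 ℤ))) : Prop :=
  IsUniformSpanningTreeMeasure (helixGraph k) (fun n : ℕ => Set.Icc (-(n : ℤ)) (n : ℤ)) P

/-- The rung process `X_m = 1_T(z_m)`, a function of the random edge set `T`. -/
def rungProcess (m : ℤ) (T : Set (Sym2 ℤ)) : ℕ :=
  Set.indicator T (fun _ => 1) (rung m)

/-- The process `X`, indexed by `R`, with values in `{0, 1}`, is a (Hermitian) determinantal point
process with matrix `A`. -/
def IsDeterminantalProcess {Ω R : Type*} [MeasurableSpace Ω] [DecidableEq R]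
    (P : Measure Ω) (X : R → Ω → ℕ) (A : Matrix R R ℂ) : Prop :=
  (∀ s, Measurable (X s)) ∧ (∀ s ω, X s ω = 0 ∨ X s ω = 1) ∧ A.IsHermitian ∧
    ∀ S : Finset R,
      ((P.real {ω | ∀ s ∈ S, X s ω = 1} : ℝ) : ℂ) =
        (A.submatrix (fun i : S => (i : R)) (fun j : S => (j : R))).det

/-- `f`, a measurable function from `[0, 1]` to `[0, 1]`, is the Fourier transform of the sequence
`a`: the numbers `a k` are the Fourier coefficients of `f`, and `f` is the sum of the Fourier
series with these coefficients. -/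
def IsFourierTransform (a : ℤ → ℂ) (f : ℝ → ℝ) : Prop :=
  Measurable f ∧ (∀ x ∈ Set.Icc (0 : ℝ) 1, f x ∈ Set.Icc (0 : ℝ) 1) ∧
    (∀ k : ℤ, a k = ∫ x in Set.Icc (0 : ℝ) 1,
      (f x : ℂ) * Complex.exp (-(2 * Real.pi * Complex.I * k * x))) ∧
    (∀ x ∈ Set.Icc (0 : ℝ) 1,
      HasSum (fun k : ℤ => a k * Complex.exp (2 * Real.pi * Complex.I * k * x)) (f x : ℂ))

/-- `η = γ^(3/2) / (4 √5) + i γ^(-3/2) / (4 √5)`, with `γ` the golden ratio. -/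
def helixEta : ℂ :=
  ((Real.goldenRatio ^ (3 / 2 : ℝ) / (4 * Real.sqrt 5) : ℝ) : ℂ) +
    Complex.I * ((Real.goldenRatio ^ (-(3 / 2) : ℝ) / (4 * Real.sqrt 5) : ℝ) : ℂ)

/-- `α = (γ^(-3/2) - 1) / 2 + i (γ^(3/2) - 1) / 2`, with `γ` the golden ratio. -/
def helixAlpha : ℂ :=
  (((Real.goldenRatio ^ (-(3 / 2) : ℝ) - 1) / 2 : ℝ) : ℂ) +
    Complex.I * (((Real.goldenRatio ^ (3 / 2 : ℝ) - 1) / 2 : ℝ) : ℂ)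

/-- `η α^|m| + conj(η) conj(α)^|m|`. -/
def helixCoeff (m : ℤ) : ℂ :=
  helixEta * helixAlpha ^ m.natAbs +
    (starRingEnd ℂ) helixEta * (starRingEnd ℂ) helixAlpha ^ m.natAbs

/-- The Toeplitz matrix with entries `a (l - k)`. -/
def toeplitz (a : ℤ → ℂ) : Matrix ℤ ℤ ℂ := Matrix.of fun k l => a (l - k)

end

/-!
The proof has a linear-algebraic part on finite windows and a limit.

Take the vertices of a finite graph to be the integers of an interval `[a, b]`, and replace the
incidence vector of an edge `{x, y}`, `x < y`, by its partial sums, the indicator vector of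
`(x, y]` (`pathVec`), indexed by `(a, b]`. This is a unimodular change of coordinates, so a family
of `b - a` edges has determinant `±1` if it spans a connected graph and `0` otherwise
(`det_pathVec_sq`). With the Cauchy-Binet formula (`factorial_card_mul_det_sum`) this gives the
weighted matrix-tree theorem `sum_spanningTrees_prod_eq_det`: the weighted number of spanning trees
is the determinant of `∑ w_e b_e b_eᵀ`. Perturbing the weights of finitely many edges changes this
determinant by the factor `det (1 + (w - 1) K)`, with `K` the transfer matrix
`b_eᵀ A⁻¹ b_f`, `A = ∑ b_e b_eᵀ`, and weights tending to infinity or equal to `0` isolate the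
trees that contain, respectively avoid, given edges. So every cylinder probability is a determinant
in `K` (`uniformOn_spanningTrees_cylinder`).

In the helix-3-graph the rungs form a path through all vertices, so their vectors are the standard
basis vectors, and that of `h_m` is the indicator of `{m - 2, m - 1, m}`. Hence `A = 1 + M Mᵀ ≥ 1`,
and away from the ends of the window `A` is the Toeplitz matrix with symbol `1 + |1 + z + z²|² = 4 +
4 cos θ + 2 cos 2θ`, `z = exp (i θ)`. A sequence `g` that decays and solves the bi-infinite equation
`A g = δ₀` (`IsHelixGreen`) solves the truncated equation up to an error at the ends that tends to
`0`. Since `A⁻¹` is a contraction, the entries of `A⁻¹` converge to those of the Toeplitz matrix of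
`g` (`tendsto_helixGreen`), hence so do the transfer matrices and all cylinder probabilities. For
rungs the limit of the transfer matrix is `g (k - l)` itself.

The sequence `helixCoeff` is such a `g`, because `α` is a root of `x² + (1 + i) x + 1`, which
divides `x⁴ + 2 x³ + 4 x² + 2 x + 1`. The same difference equation, multiplied by `z ^ k` and
summed over `k`, says that the Fourier series of `g` times the symbol is `1`.

The limiting measure exists since probability measures on `Sym2 ℤ → Bool` form a compact space and
cylinders are clopen (`exists_measure_of_tendsto_cylinder`). It is unique since the cylinders
determine a finite measure.
-/

noncomputable section

/-! ### The Cauchy-Binet formula -/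

open Finset in
/-- The Cauchy-Binet formula for `∑ w_e b_e b_eᵀ`, with a sum over tuples of indices in place of
sets of indices: every set is counted once for each of its orderings, whence the factorial. -/
theorem factorial_card_mul_det_sum {ι E R : Type*} [Fintype ι] [DecidableEq ι] [CommRing R]
    (s : Finset E) (w : E → R) (b : E → ι → R) :
    ((Fintype.card ι).factorial : R) *
        (Matrix.of fun i j => ∑ e ∈ s, w e * b e i * b e j).det =
      ∑ φ ∈ Fintype.piFinset (fun _ : ι => s),
        (∏ i, w (φ i)) * (Matrix.of fun i => b (φ i)).det ^ 2 := by
  have h1 : (Matrix.of fun i j => ∑ e ∈ s, w e * b e i * b e j).det =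
      ∑ φ ∈ Fintype.piFinset (fun _ : ι => s),
        (∏ i, w (φ i)) * (∏ i, b (φ i) i) * (Matrix.of fun i => b (φ i)).det := by
    have : (Matrix.of fun i j => ∑ e ∈ s, w e * b e i * b e j) =
        fun i => ∑ e ∈ s, (w e * b e i) • b e := by
      ext i j; simp
    rw [this]
    refine (Matrix.detRowAlternating.toMultilinearMap.map_sum_finset _ _).trans ?_
    refine sum_congr rfl fun φ _ => ?_
    refine (Matrix.detRowAlternating.toMultilinearMap.map_smul_univ _ _).trans ?_
    rw [prod_mul_distrib]
    rfl
  have h2 : ∀ σ : Equiv.Perm ι, (Matrix.of fun i j => ∑ e ∈ s, w e * b e i * b e j).det =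
      ∑ φ ∈ Fintype.piFinset (fun _ : ι => s), (∏ i, w (φ i)) *
        ((Equiv.Perm.sign σ : ℤ) * ∏ i, b (φ (σ i)) i) * (Matrix.of fun i => b (φ i)).det := by
    intro σ
    rw [h1]
    refine sum_nbij' (fun φ => φ ∘ σ.symm) (fun φ => φ ∘ σ) ?_ ?_ ?_ ?_ ?_
    · intro φ hφ; simp at hφ ⊢; intro i; exact hφ _
    · intro φ hφ; simp at hφ ⊢; intro i; exact hφ _
    · intro φ _; ext i; simp
    · intro φ _; ext i; simp
    · intro φ _
      have e1 : (Matrix.of fun i => b ((φ ∘ σ.symm) i)) =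
          (Matrix.of fun i => b (φ i)).submatrix σ.symm id := by
        ext; simp
      have e2 : ∏ i, w ((φ ∘ σ.symm) i) = ∏ i, w (φ i) :=
        Equiv.prod_comp σ.symm (fun i => w (φ i))
      have e3 : ((Equiv.Perm.sign σ : ℤ) : R) * ((Equiv.Perm.sign σ : ℤ) : R) = 1 := by
        rw [← Int.cast_mul, ← Units.val_mul, Int.units_mul_self]; simp
      rw [e1, e2, Matrix.det_permute, Equiv.Perm.sign_symm]
      simp only [Function.comp_apply, Equiv.symm_apply_apply]
      linear_combination (-(∏ i, w (φ i)) * (∏ i, b (φ i) i) *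
        (Matrix.of fun i => b (φ i)).det) * e3
  have h3 := Finset.sum_congr (rfl : (univ : Finset (Equiv.Perm ι)) = univ) fun σ _ => h2 σ
  rw [sum_const, card_univ, Fintype.card_perm, nsmul_eq_mul] at h3
  rw [h3, sum_comm]
  refine sum_congr rfl fun φ _ => ?_
  rw [← Finset.sum_mul, ← Finset.mul_sum, pow_two, mul_assoc]
  congr 2
  rw [Matrix.det_apply']
  rfl

/-! ### Path coordinates of edges -/

/-- The incidence vector of the edge `e` in path coordinates: the indicator vector of
`(e.inf, e.sup]`, restricted to `(a, b]`. It is written as the difference of the indicators of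
`i ≤ e.sup` and `i ≤ e.inf`, that is, of vectors attached to the two ends. -/
def pathVec (R : Type*) [Ring R] {a b : ℤ} (e : Sym2 ℤ) (i : Finset.Ioc a b) : R :=
  (if (i : ℤ) ≤ e.sup then 1 else 0) - (if (i : ℤ) ≤ e.inf then 1 else 0)

theorem sum_pathVec_mul {R : Type*} [Ring R] {a b : ℤ} (e : Sym2 ℤ)
    (he : ∀ v ∈ e, v ∈ Set.Icc a b) (h : ℤ → R) :
    ∑ i : Finset.Ioc a b, pathVec R e i * h i = ∑ i ∈ Finset.Ioc e.inf e.sup, h i := by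
  have hs : e.sup ≤ b ∧ a ≤ e.inf := by
    induction e with | _ x y =>
    have hx := he x (by simp)
    have hy := he y (by simp)
    simp only [Set.mem_Icc, Sym2.sup_mk, Sym2.inf_mk] at *
    omega
  have hle := e.inf_le_sup
  have hf : Finset.Ioc e.inf e.sup =
      (Finset.Ioc a b).filter (fun i => e.inf < i ∧ i ≤ e.sup) := by
    ext; simp; omega
  rw [hf, Finset.sum_filter, ← Finset.sum_coe_sort (Finset.Ioc a b)]
  refine Finset.sum_congr rfl fun i _ => ?_
  simp only [pathVec]
  split_ifs <;> first | omega | simp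

theorem sum_Ioc_sub_pred (u : ℤ → ℤ) {c d : ℤ} (h : c ≤ d) :
    ∑ i ∈ Finset.Ioc c d, (u i - u (i - 1)) = u d - u c := by
  induction d, h using Int.leInduction with
  | base => simp
  | succ d hd ih =>
    have : Finset.Ioc c (d + 1) = insert (d + 1) (Finset.Ioc c d) := by
      ext; simp; omega
    rw [this, Finset.sum_insert (by simp), ih]
    simp

open Finset in
/-- The indicator `u` of a connected component is constant on edges, so that its increments, which
are not all zero, form a vector in the kernel of the matrix. -/
theorem det_pathVec_eq_zero {a b : ℤ} (hab : a ≤ b) (φ : Finset.Ioc a b → Sym2 ℤ)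
    (hφ : ∀ i, ∀ v ∈ φ i, v ∈ Set.Icc a b)
    (hc : ¬ ((SimpleGraph.fromEdgeSet (Set.range φ)).induce (Set.Icc a b)).Connected) :
    (Matrix.of fun i => pathVec ℤ (φ i) : Matrix (Finset.Ioc a b) _ ℤ).det = 0 := by
  classical
  set H := (SimpleGraph.fromEdgeSet (Set.range φ)).induce (Set.Icc a b) with hH
  have : Nonempty (Set.Icc a b) := ⟨⟨a, by simp [hab]⟩⟩
  obtain ⟨p, q, hpq⟩ : ∃ p q, ¬ H.Reachable p q := by
    by_contra! h
    exact hc ⟨h⟩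
  let u : ℤ → ℤ := fun v => if ∃ h : v ∈ Set.Icc a b, H.Reachable p ⟨v, h⟩ then 1 else 0
  rw [← Matrix.exists_mulVec_eq_zero_iff]
  refine ⟨fun i => u i - u (i - 1), ?_, ?_⟩
  · intro h0
    have hconst : ∀ c, a ≤ c → c ≤ b → u c = u a := by
      intro c hac
      induction c, hac using Int.leInduction with
      | base => simp
      | succ c hc ih =>
        intro hcb
        have := congrFun h0 ⟨c + 1, by simp; omega⟩
        simp at this
        rw [← ih (by omega)]; omega
    have h1 := hconst p p.2.1 p.2.2
    have h2 := hconst q q.2.1 q.2.2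
    have h3 : u p = 1 := if_pos ⟨p.2, SimpleGraph.Reachable.refl _⟩
    have h4 : u q = 0 := if_neg fun ⟨_, h⟩ => hpq h
    omega
  · ext i
    have := (sum_pathVec_mul (φ i) (hφ i) fun i => u i - u (i - 1)).trans
      (sum_Ioc_sub_pred u (φ i).inf_le_sup)
    simp only [Matrix.mulVec, dotProduct, Matrix.of_apply, Pi.zero_apply]
    rw [this, sub_eq_zero]
    have hmem : φ i ∈ Set.range φ := ⟨i, rfl⟩
    have hi := hφ i
    generalize φ i = e at *
    have adj : ∀ x y, s(x, y) = e → (∃ h : x ∈ Set.Icc a b, H.Reachable p ⟨x, h⟩) →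
        (∃ h : y ∈ Set.Icc a b, H.Reachable p ⟨y, h⟩) := by
      rintro x y rfl ⟨hx, hr⟩
      refine ⟨hi y (by simp), ?_⟩
      by_cases hxy : x = y
      · subst hxy; exact hr
      · refine hr.trans (SimpleGraph.Adj.reachable ?_)
        simp only [hH, SimpleGraph.comap_adj, SimpleGraph.fromEdgeSet_adj]
        exact ⟨hmem, hxy⟩
    have : u e.sup = u e.inf := by
      have : s(e.inf, e.sup) = e := by
        induction e with | _ x y => 
        simp only [Sym2.sup_mk, Sym2.inf_mk]
        rcases le_total x y with h | h <;> simp [h, Sym2.eq_swap]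
      simp only [u]
      congr 1
      exact propext ⟨adj _ _ (by rw [Sym2.eq_swap, this]), adj _ _ this⟩
    exact this

/-- If the edges connect `[a, b]`, then their integral span contains the difference of the vectors
`i ↦ [i ≤ v]` of any two vertices `v`, in particular of adjacent integers, which give the standard
basis vectors. -/
theorem isUnit_det_pathVec {a b : ℤ} (φ : Finset.Ioc a b → Sym2 ℤ)
    (hc : ((SimpleGraph.fromEdgeSet (Set.range φ)).induce (Set.Icc a b)).Connected) :
    IsUnit (Matrix.of fun i => pathVec ℤ (φ i) : Matrix (Finset.Ioc a b) _ ℤ).det := by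
  classical
  set M : Matrix (Finset.Ioc a b) (Finset.Ioc a b) ℤ := Matrix.of fun i => pathVec ℤ (φ i)
  rw [← Matrix.isUnit_iff_isUnit_det, ← Matrix.vecMul_surjective_iff_isUnit]
  set S := LinearMap.range M.vecMulLinear with hS
  have hrow : ∀ i, pathVec ℤ (φ i) ∈ S := fun i =>
    ⟨Pi.single i 1, by simp only [Matrix.vecMulLinear_apply, Matrix.single_one_vecMul]; rfl⟩
  let p : ℤ → Finset.Ioc a b → ℤ := fun v i => if (i : ℤ) ≤ v then 1 else 0
  have hreach : ∀ x y : Set.Icc a b, p x - p y ∈ S := by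
    intro x y
    obtain ⟨w⟩ := hc.preconnected x y
    induction w with
    | nil => simp
    | @cons x y z h _ ih =>
      rw [← sub_add_sub_cancel _ (p y)]
      refine S.add_mem ?_ ih
      simp only [SimpleGraph.comap_adj, SimpleGraph.fromEdgeSet_adj] at h
      obtain ⟨⟨i, hi⟩, -⟩ := h
      have := hrow i
      rw [hi] at this
      simp only [Function.Embedding.subtype_apply] at this
      rcases le_total (x : ℤ) y with h | h
      · rw [← neg_sub]
        refine S.neg_mem ?_
        convert this using 1
        ext j
        simp only [pathVec, p, Sym2.sup_mk, Sym2.inf_mk, Pi.sub_apply, inf_of_le_left h,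
          sup_of_le_right h]
      · convert this using 1
        ext j
        simp only [pathVec, p, Sym2.sup_mk, Sym2.inf_mk, Pi.sub_apply, inf_of_le_right h,
          sup_of_le_left h]
  have htop : S = ⊤ := by
    rw [eq_top_iff, ← (Pi.basisFun ℤ (Finset.Ioc a b)).span_eq, Submodule.span_le]
    rintro _ ⟨j, rfl⟩
    have hj := Finset.mem_Ioc.1 j.2
    have hp : Pi.basisFun ℤ (Finset.Ioc a b) j = p j - p (j - 1) := by
      ext i
      simp only [Pi.basisFun_apply, Pi.single_apply, Pi.sub_apply, p, Subtype.ext_iff]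
      split_ifs <;> omega
    rw [hp]
    exact hreach ⟨j, by simp; omega⟩ ⟨j - 1, by simp; omega⟩
  intro v
  have : v ∈ S := htop ▸ Submodule.mem_top
  exact this

theorem det_pathVec_sq {R : Type*} [CommRing R] {a b : ℤ} (hab : a ≤ b)
    (φ : Finset.Ioc a b → Sym2 ℤ) (hφ : ∀ i, ∀ v ∈ φ i, v ∈ Set.Icc a b)
    [Decidable ((SimpleGraph.fromEdgeSet (Set.range φ)).induce (Set.Icc a b)).Connected] :
    (Matrix.of fun i => pathVec R (φ i) : Matrix (Finset.Ioc a b) _ R).det ^ 2 =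
      if ((SimpleGraph.fromEdgeSet (Set.range φ)).induce (Set.Icc a b)).Connected
        then 1 else 0 := by
  have h : (Matrix.of fun i => pathVec R (φ i) : Matrix (Finset.Ioc a b) _ R) =
      (Int.castRingHom R).mapMatrix (Matrix.of fun i => pathVec ℤ (φ i)) := by
    ext i j; simp [pathVec]
  rw [h, ← RingHom.map_det, ← map_pow]
  split_ifs with hc
  · rw [Int.isUnit_sq (isUnit_det_pathVec φ hc), map_one]
  · rw [det_pathVec_eq_zero hab φ hφ hc]; simp

/-! ### The weighted matrix-tree theorem -/

theorem card_edgeSet_induce_fromEdgeSet {V : Type*} (W : Set V) (t : Finset (Sym2 V))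
    (hd : ∀ e ∈ t, ¬ e.IsDiag) (hW : ∀ e ∈ t, ∀ v ∈ e, v ∈ W) :
    Nat.card ((SimpleGraph.fromEdgeSet (t : Set (Sym2 V))).induce W).edgeSet = t.card := by
  have himg : Sym2.map Subtype.val ''
      ((SimpleGraph.fromEdgeSet (t : Set (Sym2 V))).induce W).edgeSet = (t : Set (Sym2 V)) := by
    ext e
    constructor
    · rintro ⟨e, he, rfl⟩
      induction e with | _ x y =>
      simp only [SimpleGraph.mem_edgeSet, SimpleGraph.comap_adj,
        SimpleGraph.fromEdgeSet_adj] at he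
      exact he.1
    · intro he
      have h1 := hd e he
      have h2 := hW e he
      induction e with | _ x y =>
      refine ⟨s(⟨x, h2 x (by simp)⟩, ⟨y, h2 y (by simp)⟩), ?_, by simp⟩
      simp only [SimpleGraph.mem_edgeSet, SimpleGraph.comap_adj, SimpleGraph.fromEdgeSet_adj]
      exact ⟨he, h1⟩
  rw [Nat.card_coe_set_eq,
    ← Set.ncard_image_of_injective _ (Sym2.map.injective Subtype.val_injective), himg,
    Set.ncard_coe_finset]

theorem isTree_induce_fromEdgeSet_iff {V : Type*} (W : Set V) [Finite W] (t : Finset (Sym2 V))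
    (hd : ∀ e ∈ t, ¬ e.IsDiag) (hW : ∀ e ∈ t, ∀ v ∈ e, v ∈ W) :
    ((SimpleGraph.fromEdgeSet (t : Set (Sym2 V))).induce W).IsTree ↔
      ((SimpleGraph.fromEdgeSet (t : Set (Sym2 V))).induce W).Connected ∧
        t.card + 1 = Nat.card W := by
  rw [SimpleGraph.isTree_iff_connected_and_card, card_edgeSet_induce_fromEdgeSet W t hd hW]

open Finset in
/-- A set with as many elements as `ι` has `(card ι)!` enumerations by `ι`. -/
theorem sum_tuple_prod_of_image_eq {ι E R : Type*} [Fintype ι] [DecidableEq ι] [DecidableEq E]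
    [CommRing R] (s t : Finset E) (hts : t ⊆ s) (ht : t.card = Fintype.card ι) (w : E → R) :
    ∑ φ ∈ Fintype.piFinset (fun _ : ι => s) with univ.image φ = t, ∏ i, w (φ i) =
      ((Fintype.card ι).factorial : R) * ∏ e ∈ t, w e := by
  have hinj : ∀ φ : ι → E, univ.image φ = t → Function.Injective φ := by
    intro φ h
    rw [← Set.injOn_univ, ← coe_univ, ← card_image_iff, h, ht, card_univ]
  have e0 : ι ≃ t := Fintype.equivOfCardEq (by simp [ht])
  have h1 : ∀ φ ∈ (Fintype.piFinset (fun _ : ι => s)).filter (fun φ => univ.image φ = t),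
      ∏ i, w (φ i) = ∏ e ∈ t, w e := by
    intro φ hφ
    have h := (mem_filter.1 hφ).2
    rw [← h, prod_image (fun _ _ _ _ h' => hinj φ h h')]
  rw [sum_congr rfl h1, sum_const, nsmul_eq_mul]
  congr 2
  rw [← Fintype.card_perm, ← card_univ]
  symm
  refine card_bij (fun σ _ i => (e0 (σ i) : E)) ?_ ?_ ?_
  · intro σ _
    simp only [mem_filter, Fintype.mem_piFinset]
    refine ⟨fun i => hts (e0 _).2, ?_⟩
    ext x
    simp only [mem_image, mem_univ, true_and]
    refine ⟨?_, fun hx => ⟨σ.symm (e0.symm ⟨x, hx⟩), by simp⟩⟩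
    rintro ⟨i, rfl⟩
    exact (e0 _).2
  · intro σ _ τ _ h
    ext i
    have := congrFun h i
    exact e0.injective (Subtype.ext this)
  · intro φ hφ
    have h := (mem_filter.1 hφ).2
    have hm : ∀ i, φ i ∈ t := fun i => h ▸ mem_image_of_mem _ (mem_univ i)
    refine ⟨Equiv.ofBijective (fun i => e0.symm ⟨φ i, hm i⟩) ?_, mem_univ _, ?_⟩
    · refine Function.Injective.bijective_of_finite fun i j hij => ?_
      exact hinj φ h (Subtype.ext_iff.1 (e0.symm.injective hij))
    · ext i; simp

open Classical Finset in
/-- The weighted matrix-tree theorem, for a graph on the integers of an interval and in path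
coordinates: `E` is the set of edges of the induced subgraph. -/
theorem sum_spanningTrees_prod_eq_det {a b : ℤ} (hab : a ≤ b) (G : SimpleGraph ℤ)
    (E : Finset (Sym2 ℤ)) (hE : ∀ e, e ∈ E ↔ e ∈ G.edgeSet ∧ ∀ v ∈ e, v ∈ Set.Icc a b)
    (w : Sym2 ℤ → ℝ) :
    ∑ t ∈ E.powerset.filter fun t : Finset (Sym2 ℤ) => ↑t ∈ spanningTrees G (Set.Icc a b),
        ∏ e ∈ t, w e =
      (Matrix.of fun i j : Ioc a b => ∑ e ∈ E, w e * pathVec ℝ e i * pathVec ℝ e j).det := by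
  have hfac : (((Fintype.card (Ioc a b)).factorial : ℕ) : ℝ) ≠ 0 := by
    exact_mod_cast Nat.factorial_ne_zero _
  refine mul_left_cancel₀ hfac ?_
  rw [factorial_card_mul_det_sum]
  have hcard : Nat.card (Set.Icc a b) = Fintype.card (Ioc a b) + 1 := by
    simp; omega
  rw [sum_filter, mul_sum, ← sum_fiberwise_of_maps_to (g := fun φ => univ.image φ)
    (t := E.powerset)]
  swap
  · intro φ hφ
    rw [mem_powerset]
    intro e he
    obtain ⟨i, -, rfl⟩ := mem_image.1 he
    exact Fintype.mem_piFinset.1 hφ i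
  refine sum_congr rfl fun t ht => ?_
  rw [mem_powerset] at ht
  have hW : ∀ e ∈ t, ∀ v ∈ e, v ∈ Set.Icc a b := fun e he => ((hE e).1 (ht he)).2
  have hd : ∀ e ∈ t, ¬ e.IsDiag := fun e he =>
    G.not_isDiag_of_mem_edgeSet ((hE e).1 (ht he)).1
  have htree : (t : Set (Sym2 ℤ)) ∈ spanningTrees G (Set.Icc a b) ↔
      ((SimpleGraph.fromEdgeSet (t : Set (Sym2 ℤ))).induce (Set.Icc a b)).Connected ∧
        t.card = Fintype.card (Ioc a b) := by
    rw [← Nat.add_right_cancel_iff (n := 1) (m := t.card), ← hcard,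
      ← isTree_induce_fromEdgeSet_iff _ t hd hW]
    exact ⟨fun h => h.2.2, fun h => ⟨fun e he => ((hE e).1 (ht he)).1, fun e he => hW e he, h⟩⟩
  have hterm : ∀ φ ∈ (Fintype.piFinset fun _ : Ioc a b => E).filter (fun φ => univ.image φ = t),
      (∏ i, w (φ i)) * (Matrix.of fun i => pathVec ℝ (φ i)).det ^ 2 =
        if ((SimpleGraph.fromEdgeSet (t : Set (Sym2 ℤ))).induce (Set.Icc a b)).Connected
          then ∏ i, w (φ i) else 0 := by
    intro φ hφ
    have hr : Set.range φ = (t : Set (Sym2 ℤ)) := by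
      rw [← (mem_filter.1 hφ).2]; simp
    rw [det_pathVec_sq hab φ (fun i => hW _ (by rw [← mem_coe, ← hr]; exact ⟨i, rfl⟩))]
    simp only [hr, mul_ite, mul_one, mul_zero]
  rw [sum_congr rfl hterm]
  by_cases hc : ((SimpleGraph.fromEdgeSet (t : Set (Sym2 ℤ))).induce (Set.Icc a b)).Connected
  · simp only [hc, true_and, if_true] at htree ⊢
    by_cases hN : t.card = Fintype.card (Ioc a b)
    · rw [if_pos (htree.2 hN), sum_tuple_prod_of_image_eq E t ht hN]
    · rw [if_neg (fun h => hN (htree.1 h)), mul_zero, eq_comm]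
      refine sum_eq_zero fun φ hφ => absurd ?_ hN
      refine le_antisymm ?_ ?_
      · rw [← (mem_filter.1 hφ).2, ← card_univ]
        exact card_image_le
      · have := hc.card_vert_le_card_edgeSet_add_one
        rw [card_edgeSet_induce_fromEdgeSet _ t hd hW, hcard] at this
        omega
  · rw [if_neg (fun h => hc (htree.1 h).1)]
    simp [hc]

/-! ### Cylinder probabilities of uniform spanning trees -/

/-- The matrix `∑ b_e b_eᵀ`, summed over the edges `e ∈ E`, with `b_e` the vector `pathVec e`. It is
the reduced Laplacian of the graph with edge set `E` in path coordinates. -/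
def pathGram {a b : ℤ} (E : Finset (Sym2 ℤ)) : Matrix (Finset.Ioc a b) (Finset.Ioc a b) ℝ :=
  Matrix.of fun i j => ∑ e ∈ E, pathVec ℝ e i * pathVec ℝ e j

open Classical in
/-- The matrix with rows `pathVec e`, `e ∈ F`, where the rows of the pairs that are not edges
(elements of `E`) are `0`. -/
def edgeRows (a b : ℤ) (E F : Finset (Sym2 ℤ)) : Matrix F (Finset.Ioc a b) ℝ :=
  Matrix.of fun e => if (e : Sym2 ℤ) ∈ E then pathVec ℝ (e : Sym2 ℤ) else 0

/-- The transfer (current) matrix `K(e, f) = b_eᵀ A⁻¹ b_f` of the graph with edge set `E`, for `e`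
and `f` in `F`, where `A` is `pathGram E`. Its rows and columns at pairs outside `E` are `0`. -/
def transferMatrix (a b : ℤ) (E F : Finset (Sym2 ℤ)) : Matrix F F ℝ :=
  edgeRows a b E F * (pathGram E : Matrix (Finset.Ioc a b) (Finset.Ioc a b) ℝ)⁻¹ *
    (edgeRows a b E F).transpose

open Classical in
/-- The matrix whose rows are those of `K` at elements of `B` and those of `1 - K` elsewhere: if a
random set `T` is determinantal with kernel `K`, then the determinant of this matrix is the
probability of `T ∩ F = B ∩ F`. -/
def cylinderMatrix {ι : Type*} [DecidableEq ι] (F : Finset ι) (B : Set ι) (K : Matrix F F ℝ) :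
    Matrix F F ℝ :=
  Matrix.of fun e f => if (e : ι) ∈ B then K e f else (1 : Matrix F F ℝ) e f - K e f

open Classical in
/-- The effect on the tree determinant of changing the weights of the edges in `F` from `1`, by the
identity `det (1 + U V) = det (1 + V U)`. -/
theorem det_weighted_pathGram {a b : ℤ} (E F : Finset (Sym2 ℤ)) (w : Sym2 ℤ → ℝ)
    (hw : ∀ e, e ∉ F → w e = 1) (hA : (pathGram E : Matrix (Finset.Ioc a b) _ ℝ).det ≠ 0) :
    (Matrix.of fun i j : Finset.Ioc a b => ∑ e ∈ E, w e * pathVec ℝ e i * pathVec ℝ e j).det =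
      (pathGram E : Matrix (Finset.Ioc a b) _ ℝ).det *
        (1 + Matrix.diagonal (fun e : F => w e - 1) * transferMatrix a b E F).det := by
  set A : Matrix (Finset.Ioc a b) (Finset.Ioc a b) ℝ := pathGram E with hAdef
  set C := edgeRows a b E F with hC
  set D := Matrix.diagonal (fun e : F => w e - 1)
  have h1 : (Matrix.of fun i j : Finset.Ioc a b =>
      ∑ e ∈ E, w e * pathVec ℝ e i * pathVec ℝ e j) = A + C.transpose * (D * C) := by
    ext i j
    have h2 : (C.transpose * (D * C)) i j =
        ∑ e ∈ F, if e ∈ E then (w e - 1) * (pathVec ℝ e i * pathVec ℝ e j) else 0 := by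
      rw [Matrix.mul_apply, ← Finset.sum_coe_sort F]
      refine Finset.sum_congr rfl fun e _ => ?_
      simp only [D, Matrix.diagonal_mul, Matrix.transpose_apply, hC, edgeRows, Matrix.of_apply]
      split_ifs
      · ring
      · simp
    rw [Matrix.add_apply, h2, ← Finset.sum_filter, Finset.filter_mem_eq_inter, Finset.inter_comm,
      ← Finset.filter_mem_eq_inter, Finset.sum_filter, hAdef]
    simp only [Matrix.of_apply, pathGram]
    rw [← Finset.sum_add_distrib]
    refine Finset.sum_congr rfl fun e _ => ?_
    split_ifs with h
    · ring
    · rw [hw e h]; ring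
  have h3 : A + C.transpose * (D * C) = A * (1 + (A⁻¹ * C.transpose) * (D * C)) := by
    rw [mul_add, mul_one, Matrix.mul_assoc A⁻¹, Matrix.mul_nonsing_inv_cancel_left _ _
      (isUnit_iff_ne_zero.2 hA)]
  rw [h1, h3, Matrix.det_mul, Matrix.det_one_add_mul_comm, transferMatrix]
  simp only [Matrix.mul_assoc]
  rfl

open Classical Finset in
/-- The number of spanning trees `t` with `t ∩ F = B ∩ F`. The edges of `F` get the weight `0`
outside `B` and `s⁻¹` in `B`. After multiplication by a power of `s`, both sides of the matrix-tree
theorem are continuous in `s`, and their values at `s = 0` are the two sides of the claim. -/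
theorem card_spanningTrees_cylinder {a b : ℤ} (hab : a ≤ b) (G : SimpleGraph ℤ)
    (E : Finset (Sym2 ℤ)) (hE : ∀ e, e ∈ E ↔ e ∈ G.edgeSet ∧ ∀ v ∈ e, v ∈ Set.Icc a b)
    (hA : (pathGram E : Matrix (Ioc a b) _ ℝ).det ≠ 0) (F : Finset (Sym2 ℤ))
    (B : Set (Sym2 ℤ)) :
    (((E.powerset.filter fun t : Finset (Sym2 ℤ) =>
        ↑t ∈ spanningTrees G (Set.Icc a b)).filter fun t : Finset (Sym2 ℤ) =>
          ∀ e ∈ F, (e ∈ t ↔ e ∈ B)).card : ℝ) =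
      (pathGram E : Matrix (Ioc a b) _ ℝ).det *
        (cylinderMatrix F B (transferMatrix a b E F)).det := by
  set Tr := E.powerset.filter fun t : Finset (Sym2 ℤ) => ↑t ∈ spanningTrees G (Set.Icc a b)
  set K := transferMatrix a b E F
  set A : Matrix (Ioc a b) (Ioc a b) ℝ := pathGram E
  -- the contribution of `e ∈ F` to the weight of `t`, multiplied by `s` if `e ∈ B`
  let c : ℝ → Finset (Sym2 ℤ) → Sym2 ℤ → ℝ := fun s t e =>
    if e ∈ t then (if e ∈ B then 1 else 0) else (if e ∈ B then s else 1)
  let N : ℝ → Matrix F F ℝ := fun s => Matrix.of fun e f =>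
    if (e : Sym2 ℤ) ∈ B then s * (1 : Matrix F F ℝ) e f + (1 - s) * K e f
    else (1 : Matrix F F ℝ) e f - K e f
  have hne : ∀ s : ℝ, s ≠ 0 → ∑ t ∈ Tr, ∏ e ∈ F, c s t e = A.det * (N s).det := by
    intro s hs
    let w : Sym2 ℤ → ℝ := fun e => if e ∈ F then (if e ∈ B then s⁻¹ else 0) else 1
    let r : Sym2 ℤ → ℝ := fun e => if e ∈ B then s else 1
    have h1 : ∀ t ∈ Tr, ∏ e ∈ F, c s t e = (∏ e ∈ F, r e) * ∏ e ∈ t, w e := by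
      intro t _
      have h2 : ∏ e ∈ t, w e = ∏ e ∈ F, if e ∈ t then (if e ∈ B then s⁻¹ else 0) else 1 := by
        simp only [w]
        rw [← prod_filter, ← prod_filter, filter_mem_eq_inter, filter_mem_eq_inter, inter_comm]
      rw [h2, ← prod_mul_distrib]
      refine prod_congr rfl fun e _ => ?_
      simp only [c, r]
      split_ifs <;> simp [hs]
    rw [sum_congr rfl h1, ← mul_sum, sum_spanningTrees_prod_eq_det hab G E hE,
      det_weighted_pathGram E F w (fun e he => if_neg he) hA]
    have h3 : N s = Matrix.diagonal (fun e : F => r e) *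
        (1 + Matrix.diagonal (fun e : F => w e - 1) * K) := by
      ext e f
      simp only [N, r, w, Matrix.of_apply, Matrix.diagonal_mul, Matrix.add_apply, e.2, if_true]
      split_ifs
      · field_simp
      · ring
    rw [h3, Matrix.det_mul, Matrix.det_diagonal, prod_coe_sort F r]
    ring
  have hc1 : Continuous fun s => ∑ t ∈ Tr, ∏ e ∈ F, c s t e := by
    refine continuous_finsetSum _ fun t _ => continuous_finsetProd _ fun e _ => ?_
    simp only [c]
    split_ifs <;> fun_prop
  have hc2 : Continuous fun s => A.det * (N s).det := by
    refine continuous_const.mul (Continuous.matrix_det ?_)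
    refine continuous_matrix fun e f => ?_
    simp only [N, Matrix.of_apply]
    split_ifs <;> fun_prop
  have h0 := congrFun (Continuous.ext_on (dense_compl_singleton (0 : ℝ)) hc1 hc2
    fun s hs => hne s hs) 0
  have hN : N 0 = cylinderMatrix F B K := by
    ext e f; simp [N, cylinderMatrix]
  simp only [hN] at h0
  rw [← h0, card_filter, Nat.cast_sum]
  refine sum_congr rfl fun t _ => ?_
  have h4 : ∀ e ∈ F, c 0 t e = if (e ∈ t ↔ e ∈ B) then 1 else 0 := by
    intro e _
    simp only [c]
    split_ifs <;> tauto
  rw [prod_congr rfl h4, prod_boole]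
  push_cast
  rfl

theorem det_cylinderMatrix_transferMatrix_nonneg {a b : ℤ} (hab : a ≤ b) (G : SimpleGraph ℤ)
    (E : Finset (Sym2 ℤ)) (hE : ∀ e, e ∈ E ↔ e ∈ G.edgeSet ∧ ∀ v ∈ e, v ∈ Set.Icc a b)
    (hA : (pathGram E : Matrix (Finset.Ioc a b) _ ℝ).det ≠ 0) (F : Finset (Sym2 ℤ))
    (B : Set (Sym2 ℤ)) : 0 ≤ (cylinderMatrix F B (transferMatrix a b E F)).det := by
  have h1 := (card_spanningTrees_cylinder hab G E hE hA F B).symm.trans_ge (Nat.cast_nonneg _)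
  have h2 := (card_spanningTrees_cylinder hab G E hE hA ∅ ∅).symm.trans_ge (Nat.cast_nonneg _)
  simp only [Matrix.det_isEmpty, mul_one] at h2
  exact nonneg_of_mul_nonneg_right h1 (lt_of_le_of_ne h2 hA.symm)

open Classical in
theorem uniformOn_spanningTrees_cylinder {a b : ℤ} (hab : a ≤ b) (G : SimpleGraph ℤ)
    (E : Finset (Sym2 ℤ)) (hE : ∀ e, e ∈ E ↔ e ∈ G.edgeSet ∧ ∀ v ∈ e, v ∈ Set.Icc a b)
    (hA : (pathGram E : Matrix (Finset.Ioc a b) _ ℝ).det ≠ 0) (F : Finset (Sym2 ℤ))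
    (B : Set (Sym2 ℤ)) :
    uniformOn (spanningTrees G (Set.Icc a b)) {T | ∀ e ∈ F, (e ∈ T ↔ e ∈ B)} =
      ENNReal.ofReal (cylinderMatrix F B (transferMatrix a b E F)).det := by
  set Tr := E.powerset.filter fun t : Finset (Sym2 ℤ) => ↑t ∈ spanningTrees G (Set.Icc a b)
    with hTr
  let c : Finset (Sym2 ℤ) ↪ Set (Sym2 ℤ) := ⟨fun t => ↑t, Finset.coe_injective⟩
  have h1 : spanningTrees G (Set.Icc a b) = ((Tr.map c : Finset _) : Set (Set (Sym2 ℤ))) := by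
    ext t
    simp only [Finset.coe_map, Set.mem_image, Finset.mem_coe, hTr, Finset.mem_filter,
      Finset.mem_powerset, c, Function.Embedding.coeFn_mk]
    constructor
    · intro ht
      have hsub : t ⊆ E := fun e he => (hE e).2 ⟨ht.1 he, ht.2.1 e he⟩
      have hfin := E.finite_toSet.subset hsub
      exact ⟨hfin.toFinset, ⟨by simpa using hsub, by simpa using ht⟩, by simp⟩
    · rintro ⟨t, ⟨-, ht⟩, rfl⟩
      exact ht
  have h2 : (Tr.map c : Set (Set (Sym2 ℤ))) ∩ {T | ∀ e ∈ F, (e ∈ T ↔ e ∈ B)} =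
      (((Tr.filter fun t : Finset (Sym2 ℤ) => ∀ e ∈ F, (e ∈ t ↔ e ∈ B)).map c : Finset _) :
        Set (Set (Sym2 ℤ))) := by
    ext t
    simp only [Finset.coe_map, Set.mem_inter_iff, Set.mem_image, Finset.mem_coe,
      Finset.mem_filter, Set.mem_ofPred_eq, c, Function.Embedding.coeFn_mk]
    constructor
    · rintro ⟨⟨t, ht, rfl⟩, h⟩
      exact ⟨t, ⟨ht, by simpa using h⟩, rfl⟩
    · rintro ⟨t, ⟨ht, h⟩, rfl⟩
      exact ⟨⟨t, ht, rfl⟩, by simpa using h⟩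
  have h3 := card_spanningTrees_cylinder hab G E hE hA F B
  have h4 := card_spanningTrees_cylinder hab G E hE hA ∅ ∅
  -- for `F = ∅` the count says that the number of all spanning trees is `det A`
  simp only [Finset.notMem_empty, IsEmpty.forall_iff, implies_true, Finset.filter_true,
    Matrix.det_isEmpty, mul_one] at h4
  rw [h1, ← uniformOn_inter_self (Finset.finite_toSet _), h2, uniformOn_apply_finset,
    Finset.inter_eq_right.2 (Finset.map_subset_map.2 (Finset.filter_subset _ _)),
    Finset.card_map, Finset.card_map]
  have h5 : (cylinderMatrix F B (transferMatrix a b E F)).det =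
      ((Tr.filter fun t : Finset (Sym2 ℤ) => ∀ e ∈ F, (e ∈ t ↔ e ∈ B)).card : ℝ) /
        (Tr.card : ℝ) := by
    rw [h3, h4]; field_simp
  have h6 : (0 : ℝ) < Tr.card := by
    rcases (Nat.cast_nonneg (α := ℝ) Tr.card).eq_or_lt with h | h
    · exact absurd (h.trans h4).symm hA
    · exact h
  rw [h5, ENNReal.ofReal_div_of_pos h6, ENNReal.ofReal_natCast, ENNReal.ofReal_natCast]

/-! ### Green's function of the helix-3-graph -/

section HelixGreen

open Matrix

theorem rung_mem_iff (m v : ℤ) : v ∈ rung m ↔ v = m - 1 ∨ v = m := Sym2.mem_iff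
theorem longEdge_mem_iff (m v : ℤ) : v ∈ longEdge 3 m ↔ v = m - 3 ∨ v = m := Sym2.mem_iff

theorem rung_inf_sup (m : ℤ) : (rung m).inf = m - 1 ∧ (rung m).sup = m := by
  simp [rung, Sym2.inf_mk, Sym2.sup_mk]

theorem longEdge_inf_sup (m : ℤ) : (longEdge 3 m).inf = m - 3 ∧ (longEdge 3 m).sup = m := by
  simp [longEdge, Sym2.inf_mk, Sym2.sup_mk]

theorem mem_edgeSet_helixGraph (e : Sym2 ℤ) :
    e ∈ (helixGraph 3).edgeSet ↔ ∃ m : ℤ, e = rung m ∨ e = longEdge 3 m := by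
  rw [helixGraph, SimpleGraph.edgeSet_fromEdgeSet]
  refine ⟨fun h => h.1, fun h => ⟨h, ?_⟩⟩
  obtain ⟨m, rfl | rfl⟩ := h <;> simp [rung, longEdge]

/-- The edges of the subgraph of the helix-3-graph induced on `{-n, …, n}`. -/
def helixEdges (n : ℕ) : Finset (Sym2 ℤ) :=
  (Finset.Ioc (-(n : ℤ)) n).image rung ∪ (Finset.Icc (-(n : ℤ) + 3) n).image (longEdge 3)

theorem mem_helixEdges (n : ℕ) (e : Sym2 ℤ) :
    e ∈ helixEdges n ↔
      e ∈ (helixGraph 3).edgeSet ∧ ∀ v ∈ e, v ∈ Set.Icc (-(n : ℤ)) n := by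
  rw [mem_edgeSet_helixGraph, helixEdges, Finset.mem_union, Finset.mem_image, Finset.mem_image]
  constructor
  · rintro (⟨m, hm, rfl⟩ | ⟨m, hm, rfl⟩)
    · refine ⟨⟨m, Or.inl rfl⟩, fun v hv => ?_⟩
      rw [Finset.mem_Ioc] at hm
      rw [rung_mem_iff] at hv
      rw [Set.mem_Icc]
      omega
    · refine ⟨⟨m, Or.inr rfl⟩, fun v hv => ?_⟩
      rw [Finset.mem_Icc] at hm
      rw [longEdge_mem_iff] at hv
      rw [Set.mem_Icc]
      omega
  · rintro ⟨⟨m, rfl | rfl⟩, h⟩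
    · have h1 := h (m - 1) ((rung_mem_iff _ _).2 (Or.inl rfl))
      have h2 := h m ((rung_mem_iff _ _).2 (Or.inr rfl))
      rw [Set.mem_Icc] at h1 h2
      exact Or.inl ⟨m, by rw [Finset.mem_Ioc]; omega, rfl⟩
    · have h1 := h (m - 3) ((longEdge_mem_iff _ _).2 (Or.inl rfl))
      have h2 := h m ((longEdge_mem_iff _ _).2 (Or.inr rfl))
      rw [Set.mem_Icc] at h1 h2
      exact Or.inr ⟨m, by rw [Finset.mem_Icc]; omega, rfl⟩

theorem sum_helixEdges (n : ℕ) (f : Sym2 ℤ → ℝ) :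
    ∑ e ∈ helixEdges n, f e = ∑ m ∈ Finset.Ioc (-(n : ℤ)) n, f (rung m) +
      ∑ m ∈ Finset.Icc (-(n : ℤ) + 3) n, f (longEdge 3 m) := by
  rw [helixEdges, Finset.sum_union, Finset.sum_image, Finset.sum_image]
  · intro x _ y _ h
    rw [← (longEdge_inf_sup x).2, h, (longEdge_inf_sup y).2]
  · intro x _ y _ h
    rw [← (rung_inf_sup x).2, h, (rung_inf_sup y).2]
  · rw [Finset.disjoint_left]
    intro e h1 h2
    obtain ⟨x, -, rfl⟩ := Finset.mem_image.1 h1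
    obtain ⟨y, -, h⟩ := Finset.mem_image.1 h2
    have h3 := longEdge_inf_sup y
    have h4 := rung_inf_sup x
    rw [h] at h3
    omega

/-- The matrix `∑ b_e b_eᵀ` of the subgraph of the helix-3-graph induced on `{-n, …, n}`. -/
abbrev helixGram (n : ℕ) : Matrix (Finset.Ioc (-(n : ℤ)) n) (Finset.Ioc (-(n : ℤ)) n) ℝ :=
  pathGram (helixEdges n)

theorem pathGram_mulVec {a b : ℤ} (E : Finset (Sym2 ℤ)) (h : Finset.Ioc a b → ℝ)
    (i : Finset.Ioc a b) :
    (pathGram E *ᵥ h) i = ∑ e ∈ E, pathVec ℝ e i * ∑ j, pathVec ℝ e j * h j := by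
  simp only [mulVec, dotProduct, pathGram, of_apply, Finset.sum_mul, Finset.mul_sum]
  rw [Finset.sum_comm]
  simp only [mul_assoc]

theorem rung_subset {n : ℕ} {m : ℤ} (hm : m ∈ Finset.Ioc (-(n : ℤ)) n) :
    ∀ v ∈ rung m, v ∈ Set.Icc (-(n : ℤ)) n :=
  ((mem_helixEdges n _).1 (Finset.mem_union_left _ (Finset.mem_image_of_mem _ hm))).2

theorem longEdge_subset {n : ℕ} {m : ℤ} (hm : m ∈ Finset.Icc (-(n : ℤ) + 3) n) :
    ∀ v ∈ longEdge 3 m, v ∈ Set.Icc (-(n : ℤ)) n :=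
  ((mem_helixEdges n _).1 (Finset.mem_union_right _ (Finset.mem_image_of_mem _ hm))).2

theorem sum_pathVec_rung {n : ℕ} {m : ℤ} (hm : m ∈ Finset.Ioc (-(n : ℤ)) n) (h : ℤ → ℝ) :
    ∑ i : Finset.Ioc (-(n : ℤ)) n, pathVec ℝ (rung m) i * h i = h m := by
  rw [sum_pathVec_mul _ (rung_subset hm), (rung_inf_sup m).1, (rung_inf_sup m).2]
  have : Finset.Ioc (m - 1) m = {m} := by ext; simp; omega
  rw [this, Finset.sum_singleton]

theorem sum_pathVec_longEdge {n : ℕ} {m : ℤ} (hm : m ∈ Finset.Icc (-(n : ℤ) + 3) n)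
    (h : ℤ → ℝ) :
    ∑ i : Finset.Ioc (-(n : ℤ)) n, pathVec ℝ (longEdge 3 m) i * h i =
      h m + h (m - 1) + h (m - 2) := by
  rw [sum_pathVec_mul _ (longEdge_subset hm), (longEdge_inf_sup m).1, (longEdge_inf_sup m).2]
  have : Finset.Ioc (m - 3) m = {m, m - 1, m - 2} := by ext; simp; omega
  rw [this, Finset.sum_insert, Finset.sum_insert, Finset.sum_singleton, add_assoc]
  all_goals simp; try omega

/-- The rungs alone contribute the identity matrix to `helixGram n`. -/
theorem dotProduct_self_le_helixGram (n : ℕ) (u : Finset.Ioc (-(n : ℤ)) n → ℝ) :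
    u ⬝ᵥ u ≤ u ⬝ᵥ (helixGram n *ᵥ u) := by
  let h : ℤ → ℝ := fun i => if hi : i ∈ Finset.Ioc (-(n : ℤ)) n then u ⟨i, hi⟩ else 0
  have hh : ∀ i : Finset.Ioc (-(n : ℤ)) n, u i = h i := fun i => by simp only [h, i.2, dif_pos]
  have h1 : u ⬝ᵥ (helixGram n *ᵥ u) =
      ∑ e ∈ helixEdges n, (∑ i, pathVec ℝ e i * u i) ^ 2 := by
    simp only [dotProduct, pathGram_mulVec, Finset.mul_sum (s := helixEdges n)]
    rw [Finset.sum_comm]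
    refine Finset.sum_congr rfl fun e _ => ?_
    rw [pow_two, Finset.sum_mul]
    refine Finset.sum_congr rfl fun i _ => ?_
    ring
  rw [h1, sum_helixEdges]
  refine le_trans (le_of_eq ?_) (le_add_of_nonneg_right (Finset.sum_nonneg fun _ _ => sq_nonneg _))
  rw [dotProduct, ← Finset.sum_coe_sort (Finset.Ioc (-(n : ℤ)) n)]
  refine Finset.sum_congr rfl fun m _ => ?_
  simp only [hh]
  rw [sum_pathVec_rung m.2, pow_two]

theorem det_helixGram_ne_zero (n : ℕ) : (helixGram n).det ≠ 0 := by
  intro h0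
  obtain ⟨v, hv, h⟩ := Matrix.exists_mulVec_eq_zero_iff.2 h0
  have := dotProduct_self_le_helixGram n v
  rw [h, dotProduct_zero] at this
  exact hv (dotProduct_self_eq_zero.1 (le_antisymm this
    (Finset.sum_nonneg fun i _ => mul_self_nonneg _)))

/-- `g` is a Green's function of the helix-3-graph in path coordinates: it is even, it tends to `0`,
and it solves `A g = δ₀` for the bi-infinite Toeplitz matrix `A` with rows `1, 2, 4, 2, 1`. -/
def IsHelixGreen (g : ℤ → ℝ) : Prop :=
  (∀ m, g (-m) = g m) ∧
  (∀ m, 4 * g m + 2 * g (m - 1) + 2 * g (m + 1) + g (m - 2) + g (m + 2) = if m = 0 then 1 else 0) ∧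
  Tendsto g atTop (𝓝 0)

/-- The long edges that contribute to row `i` are the `h_m` with `i ≤ m ≤ i + 2` that lie in the
window. For `i` away from the ends of the window these are all three. -/
theorem helixGram_mulVec (n : ℕ) (h : ℤ → ℝ) (i : Finset.Ioc (-(n : ℤ)) n) :
    (helixGram n *ᵥ fun j => h j) i = h i + ∑ m ∈ Finset.Icc (i : ℤ) (i + 2),
      if m ∈ Finset.Icc (-(n : ℤ) + 3) n then h m + h (m - 1) + h (m - 2) else 0 := by
  rw [pathGram_mulVec, sum_helixEdges]
  congr 1
  · rw [Finset.sum_congr rfl fun m hm => by rw [sum_pathVec_rung hm]]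
    rw [Finset.sum_eq_single_of_mem (i : ℤ) i.2]
    · simp [pathVec, rung_inf_sup]
    · intro m _ hmi
      simp only [pathVec, rung_inf_sup]
      split_ifs <;> first | omega | simp
  · rw [Finset.sum_congr rfl fun m hm => by rw [sum_pathVec_longEdge hm]]
    rw [← Finset.sum_filter, Finset.filter_mem_eq_inter, Finset.inter_comm,
      ← Finset.filter_mem_eq_inter, Finset.sum_filter]
    refine Finset.sum_congr rfl fun m _ => ?_
    simp only [pathVec, longEdge_inf_sup, Finset.mem_Icc]
    split_ifs <;> first | omega | simp

/-- Since `helixGram n ≥ 1`, its inverse is a contraction of the Euclidean norm. -/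
theorem sq_apply_le_sum_sq_helixGram_mulVec (n : ℕ) (u : Finset.Ioc (-(n : ℤ)) n → ℝ)
    (i : Finset.Ioc (-(n : ℤ)) n) :
    u i ^ 2 ≤ ∑ j, (helixGram n *ᵥ u) j ^ 2 := by
  have h1 := dotProduct_self_le_helixGram n u
  have h2 : u i ^ 2 ≤ u ⬝ᵥ u := by
    rw [dotProduct, pow_two]
    exact Finset.single_le_sum (f := fun i => u i * u i) (fun j _ => mul_self_nonneg _)
      (Finset.mem_univ i)
  have h3 : 2 * (u ⬝ᵥ (helixGram n *ᵥ u)) ≤ u ⬝ᵥ u + ∑ j, (helixGram n *ᵥ u) j ^ 2 := by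
    simp only [dotProduct, Finset.mul_sum, ← Finset.sum_add_distrib]
    exact Finset.sum_le_sum fun j _ => by nlinarith [sq_nonneg (u j - (helixGram n *ᵥ u) j)]
  linarith

/-- The inverse of `helixGram n`, extended by `0` to a matrix indexed by all integers. -/
def helixGreen (n : ℕ) (i j : ℤ) : ℝ :=
  if h : i ∈ Finset.Ioc (-(n : ℤ)) n ∧ j ∈ Finset.Ioc (-(n : ℤ)) n then
    (helixGram n)⁻¹ ⟨i, h.1⟩ ⟨j, h.2⟩ else 0

/-- The vector `u = A⁻¹ δ_k - g (· - k)` solves `A u = ρ`, where the error `ρ` of `g` in the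
truncated equation comes from the missing long edges and is supported on two rows at either end of
the window. -/
theorem tendsto_helixGreen {g : ℤ → ℝ} (hg : IsHelixGreen g) (l k : ℤ) :
    Tendsto (fun n => helixGreen n l k) atTop (𝓝 (g (l - k))) := by
  obtain ⟨heven, heq, hlim⟩ := hg
  -- the inner product of `g (· - k)` with the vector of `h_m`
  let s : ℤ → ℝ := fun m => g (m - k) + g (m - 1 - k) + g (m - 2 - k)
  have hbound : ∀ᶠ n : ℕ in atTop, (helixGreen n l k - g (l - k)) ^ 2 ≤
      (s (-n + 1) + s (-n + 2)) ^ 2 + s (-n + 2) ^ 2 + s (n + 1) ^ 2 +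
        (s (n + 1) + s (n + 2)) ^ 2 := by
    filter_upwards [eventually_ge_atTop (l.natAbs + k.natAbs + 4)] with n hn
    have hl : l ∈ Finset.Ioc (-(n : ℤ)) n := by rw [Finset.mem_Ioc]; omega
    have hk : k ∈ Finset.Ioc (-(n : ℤ)) n := by rw [Finset.mem_Ioc]; omega
    let u : Finset.Ioc (-(n : ℤ)) n → ℝ := fun i =>
      (helixGram n)⁻¹ i ⟨k, hk⟩ - g (i - k)
    have hu : u ⟨l, hl⟩ = helixGreen n l k - g (l - k) := by
      simp only [u, helixGreen, dif_pos (And.intro hl hk)]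
    let ρ : ℤ → ℝ := fun i => ∑ m ∈ Finset.Icc i (i + 2),
      if m ∈ Finset.Icc (-(n : ℤ) + 3) n then 0 else s m
    have hIcc : ∀ i : ℤ, Finset.Icc i (i + 2) = {i, i + 1, i + 2} := by
      intro i; ext; simp; omega
    have hsum : ∀ (i : ℤ) (f : ℤ → ℝ), ∑ m ∈ Finset.Icc i (i + 2), f m =
        f i + f (i + 1) + f (i + 2) := by
      intro i f
      rw [hIcc, Finset.sum_insert, Finset.sum_insert, Finset.sum_singleton, add_assoc]
      all_goals simp
    have hAu : ∀ i, (helixGram n *ᵥ u) i = ρ i := by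
      intro i
      have e1 : u = (helixGram n)⁻¹ *ᵥ (Pi.single ⟨k, hk⟩ 1) -
          fun i : Finset.Ioc (-(n : ℤ)) n => g (i - k) := by
        ext i; simp [u]
      rw [e1, mulVec_sub, mulVec_mulVec, Matrix.mul_nonsing_inv _
        (isUnit_iff_ne_zero.2 (det_helixGram_ne_zero n)), one_mulVec, Pi.sub_apply,
        helixGram_mulVec n (fun i => g (i - k))]
      have e2 : ρ i + (∑ m ∈ Finset.Icc (i : ℤ) (i + 2),
          if m ∈ Finset.Icc (-(n : ℤ) + 3) n then
            g (m - k) + g (m - 1 - k) + g (m - 2 - k) else 0) =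
          s i + s (i + 1) + s (i + 2) := by
        rw [← hsum i s]
        simp only [ρ]
        rw [← Finset.sum_add_distrib]
        refine Finset.sum_congr rfl fun m _ => ?_
        split_ifs <;> simp [s]
      have e3 := heq (i - k)
      have e4 : (Pi.single ⟨k, hk⟩ 1 : Finset.Ioc (-(n : ℤ)) n → ℝ) i =
          if (i : ℤ) - k = 0 then 1 else 0 := by
        simp only [Pi.single_apply, Subtype.ext_iff, sub_eq_zero]
      have e5 : s i + s (i + 1) + s (i + 2) = (if (i : ℤ) - k = 0 then 1 else 0) - g (i - k) := by
        rw [← e3]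
        simp only [s]
        rw [show (i : ℤ) + 1 - k = i - k + 1 by ring, show (i : ℤ) + 2 - k = i - k + 2 by ring,
          show (i : ℤ) - 1 - k = i - k - 1 by ring, show (i : ℤ) - 2 - k = i - k - 2 by ring,
          show (i : ℤ) + 1 - 1 - k = i - k by ring, show (i : ℤ) + 1 - 2 - k = i - k - 1 by ring,
          show (i : ℤ) + 2 - 1 - k = i - k + 1 by ring, show (i : ℤ) + 2 - 2 - k = i - k by ring]
        ring
      rw [e4]
      linarith
    have hle := sq_apply_le_sum_sq_helixGram_mulVec n u ⟨l, hl⟩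
    rw [hu] at hle
    refine hle.trans (le_of_eq ?_)
    simp only [hAu]
    rw [Finset.sum_coe_sort (Finset.Ioc (-(n : ℤ)) n) (fun i => ρ i ^ 2)]
    have hsub : ({-(n : ℤ) + 1, -(n : ℤ) + 2, (n : ℤ) - 1, (n : ℤ)} : Finset ℤ) ⊆
        Finset.Ioc (-(n : ℤ)) n := by
      intro x; simp; omega
    rw [← Finset.sum_subset hsub]
    · rw [Finset.sum_insert, Finset.sum_insert, Finset.sum_insert, Finset.sum_singleton]
      · simp only [ρ, hsum, Finset.mem_Icc]
        rw [if_neg (by omega), if_neg (by omega), if_pos (by omega), if_neg (by omega),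
          if_pos (by omega), if_pos (by omega), if_pos (by omega), if_pos (by omega),
          if_neg (by omega), if_pos (by omega), if_neg (by omega), if_neg (by omega)]
        rw [show (-(n : ℤ) + 1 + 1) = -n + 2 by ring, show ((n : ℤ) - 1 + 2) = n + 1 by ring]
        ring
      all_goals simp; try omega
    · intro i hi hi'
      simp only [Finset.mem_insert, Finset.mem_singleton, not_or, Finset.mem_Ioc] at hi hi'
      simp only [ρ, hsum, Finset.mem_Icc]
      rw [if_pos (by omega), if_pos (by omega), if_pos (by omega)]
      simp
  have hgt : ∀ c : ℤ, Tendsto (fun n : ℕ => g (n + c)) atTop (𝓝 0) := fun c =>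
    hlim.comp (tendsto_atTop_add_const_right _ _ tendsto_natCast_atTop_atTop)
  have hgb : ∀ c : ℤ, Tendsto (fun n : ℕ => g (-n + c)) atTop (𝓝 0) := by
    intro c
    refine (hgt (-c)).congr fun n => ?_
    rw [← heven]; congr 1; ring
  have hst : ∀ c : ℤ, Tendsto (fun n : ℕ => s (n + c)) atTop (𝓝 0) := by
    intro c
    have := ((hgt (c - k)).add (hgt (c - 1 - k))).add (hgt (c - 2 - k))
    simp only [add_zero] at this
    refine this.congr fun n => ?_
    simp only [s]
    congr 1; congr 1
    all_goals congr 1; ring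
  have hsb : ∀ c : ℤ, Tendsto (fun n : ℕ => s (-n + c)) atTop (𝓝 0) := by
    intro c
    have := ((hgb (c - k)).add (hgb (c - 1 - k))).add (hgb (c - 2 - k))
    simp only [add_zero] at this
    refine this.congr fun n => ?_
    simp only [s]
    congr 1; congr 1
    all_goals congr 1; ring
  have hz := ((((hsb 1).add (hsb 2)).pow 2).add ((hsb 2).pow 2)).add ((hst 1).pow 2) |>.add
    (((hst 1).add (hst 2)).pow 2)
  norm_num at hz
  have hsq : Tendsto (fun n => (helixGreen n l k - g (l - k)) ^ 2) atTop (𝓝 0) :=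
    tendsto_of_tendsto_of_tendsto_of_le_of_le' tendsto_const_nhds hz
      (Eventually.of_forall fun _ => sq_nonneg _) hbound
  rw [tendsto_iff_norm_sub_tendsto_zero]
  have := hsq.sqrt
  simpa [Real.sqrt_sq_eq_abs] using this

open Classical in
/-- The limit of the transfer matrices: `b_eᵀ G b_f` for the bi-infinite Toeplitz matrix `G` with
entries `g (i - j)`, and `0` if `e` or `f` is not an edge of the helix-3-graph. -/
def helixKernel (g : ℤ → ℝ) (e f : Sym2 ℤ) : ℝ :=
  if e ∈ (helixGraph 3).edgeSet ∧ f ∈ (helixGraph 3).edgeSet then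
    ∑ i ∈ Finset.Ioc e.inf e.sup, ∑ j ∈ Finset.Ioc f.inf f.sup, g (i - j) else 0

theorem eventually_mem_helixEdges (e : Sym2 ℤ) (he : e ∈ (helixGraph 3).edgeSet) :
    ∀ᶠ n : ℕ in atTop, e ∈ helixEdges n := by
  induction e with | _ x y =>
  filter_upwards [eventually_ge_atTop (x.natAbs + y.natAbs)] with n hn
  rw [mem_helixEdges]
  refine ⟨he, fun v hv => ?_⟩
  rw [Sym2.mem_iff] at hv
  rw [Set.mem_Icc]
  omega

theorem tendsto_transferMatrix {g : ℤ → ℝ} (hg : IsHelixGreen g) (F : Finset (Sym2 ℤ))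
    (e f : F) :
    Tendsto (fun n : ℕ => transferMatrix (-(n : ℤ)) n (helixEdges n) F e f) atTop
      (𝓝 (helixKernel g e f)) := by
  have hK : ∀ n : ℕ, transferMatrix (-(n : ℤ)) n (helixEdges n) F e f =
      ∑ i, ∑ j, edgeRows (-(n : ℤ)) n (helixEdges n) F e i *
        (edgeRows (-(n : ℤ)) n (helixEdges n) F f j * helixGreen n i j) := by
    intro n
    simp only [transferMatrix, Matrix.mul_apply, Finset.sum_mul, Matrix.transpose_apply]
    rw [Finset.sum_comm]
    refine Finset.sum_congr rfl fun i _ => Finset.sum_congr rfl fun j _ => ?_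
    rw [helixGreen, dif_pos ⟨i.2, j.2⟩]
    ring
  by_cases h : (e : Sym2 ℤ) ∈ (helixGraph 3).edgeSet ∧ (f : Sym2 ℤ) ∈ (helixGraph 3).edgeSet
  · rw [helixKernel, if_pos h]
    have ht : Tendsto (fun n : ℕ => ∑ i ∈ Finset.Ioc (e : Sym2 ℤ).inf (e : Sym2 ℤ).sup,
        ∑ j ∈ Finset.Ioc (f : Sym2 ℤ).inf (f : Sym2 ℤ).sup, helixGreen n i j) atTop
        (𝓝 (∑ i ∈ Finset.Ioc (e : Sym2 ℤ).inf (e : Sym2 ℤ).sup,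
          ∑ j ∈ Finset.Ioc (f : Sym2 ℤ).inf (f : Sym2 ℤ).sup, g (i - j))) :=
      tendsto_finsetSum _ fun i _ => tendsto_finsetSum _ fun j _ => tendsto_helixGreen hg i j
    refine ht.congr' ?_
    filter_upwards [eventually_mem_helixEdges _ h.1, eventually_mem_helixEdges _ h.2]
      with n h1 h2
    rw [hK]
    simp only [edgeRows, Matrix.of_apply, if_pos h1, if_pos h2, ← Finset.mul_sum]
    rw [← sum_pathVec_mul _ ((mem_helixEdges n _).1 h1).2
      (fun i => ∑ j ∈ Finset.Ioc (f : Sym2 ℤ).inf (f : Sym2 ℤ).sup, helixGreen n i j)]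
    refine Finset.sum_congr rfl fun i _ => ?_
    rw [← sum_pathVec_mul _ ((mem_helixEdges n _).1 h2).2]
  · rw [helixKernel, if_neg h]
    refine tendsto_const_nhds.congr fun n => ?_
    rw [hK]
    symm
    refine Finset.sum_eq_zero fun i _ => Finset.sum_eq_zero fun j _ => ?_
    rw [not_and_or] at h
    simp only [edgeRows, Matrix.of_apply]
    rcases h with h | h
    · rw [if_neg fun h' => h ((mem_helixEdges n _).1 h').1]; simp
    · rw [if_neg (c := (f : Sym2 ℤ) ∈ _) fun h' => h ((mem_helixEdges n _).1 h').1]; simp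

theorem tendsto_det_cylinderMatrix {g : ℤ → ℝ} (hg : IsHelixGreen g) (F : Finset (Sym2 ℤ))
    (B : Set (Sym2 ℤ)) :
    Tendsto (fun n : ℕ =>
        (cylinderMatrix F B (transferMatrix (-(n : ℤ)) n (helixEdges n) F)).det) atTop
      (𝓝 (cylinderMatrix F B (Matrix.of fun e f : F => helixKernel g e f)).det) := by
  have hc : Continuous fun K : Matrix F F ℝ => (cylinderMatrix F B K).det := by
    refine Continuous.matrix_det (continuous_matrix fun e f => ?_)
    simp only [cylinderMatrix, Matrix.of_apply]
    split_ifs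
    · exact continuous_id.matrix_elem e f
    · exact continuous_const.sub (continuous_id.matrix_elem e f)
  refine (hc.tendsto _).comp ?_
  exact tendsto_pi_nhds.2 fun e => tendsto_pi_nhds.2 fun f => tendsto_transferMatrix hg F e f

/-- These determinants are limits of probabilities. So `ENNReal.ofReal` below does not truncate. -/
theorem det_cylinderMatrix_helixKernel_nonneg {g : ℤ → ℝ} (hg : IsHelixGreen g)
    (F : Finset (Sym2 ℤ)) (B : Set (Sym2 ℤ)) :
    0 ≤ (cylinderMatrix F B (Matrix.of fun e f : F => helixKernel g e f)).det :=
  ge_of_tendsto' (tendsto_det_cylinderMatrix hg F B) fun n =>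
    det_cylinderMatrix_transferMatrix_nonneg (by omega) _ _ (mem_helixEdges n)
      (det_helixGram_ne_zero n) F B

theorem tendsto_uniformOn_helix {g : ℤ → ℝ} (hg : IsHelixGreen g) (F : Finset (Sym2 ℤ))
    (B : Set (Sym2 ℤ)) :
    Tendsto (fun n : ℕ => uniformOn
        (spanningTrees (helixGraph 3) (Set.Icc (-(n : ℤ)) (n : ℤ)))
        {T | ∀ e ∈ F, (e ∈ T ↔ e ∈ B)}) atTop
      (𝓝 (ENNReal.ofReal
        (cylinderMatrix F B (Matrix.of fun e f : F => helixKernel g e f)).det)) := by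
  have h1 : ∀ n : ℕ, uniformOn (spanningTrees (helixGraph 3) (Set.Icc (-(n : ℤ)) (n : ℤ)))
      {T | ∀ e ∈ F, (e ∈ T ↔ e ∈ B)} = ENNReal.ofReal
        (cylinderMatrix F B (transferMatrix (-(n : ℤ)) n (helixEdges n) F)).det := fun n =>
    uniformOn_spanningTrees_cylinder (by omega) _ _ (mem_helixEdges n)
      (det_helixGram_ne_zero n) F B
  simp only [h1]
  exact ENNReal.tendsto_ofReal (tendsto_det_cylinderMatrix hg F B)

end HelixGreen

/-! ### Measures on sets with prescribed cylinder probabilities -/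

theorem measurableSet_cylinder_prescribed {ι : Type*} (F : Finset ι) (B : Set ι) :
    MeasurableSet {T : Set ι | ∀ e ∈ F, (e ∈ T ↔ e ∈ B)} := by
  have : {T : Set ι | ∀ e ∈ F, (e ∈ T ↔ e ∈ B)} =
      ⋂ e ∈ F, {T : Set ι | e ∈ T ↔ e ∈ B} := by ext; simp
  rw [this]
  refine Finset.measurableSet_biInter _ fun e _ => ?_
  by_cases h : e ∈ B
  · simpa [h] using measurableSet_mem e
  · simpa [h] using measurableSet_notMem e

/-- A finite measure on the sets of elements of `ι` is determined by its cylinder probabilities. -/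
theorem measure_ext_of_cylinder {ι : Type*} {P Q : Measure (Set ι)}
    [IsFiniteMeasure P] [IsFiniteMeasure Q]
    (h : ∀ (F : Finset ι) (B : Set ι),
      P {T | ∀ e ∈ F, (e ∈ T ↔ e ∈ B)} = Q {T | ∀ e ∈ F, (e ∈ T ↔ e ∈ B)}) : P = Q := by
  let P' : Measure (ι → Prop) := P
  let Q' : Measure (ι → Prop) := Q
  have : IsFiniteMeasure P' := ‹IsFiniteMeasure P›
  have : IsFiniteMeasure Q' := ‹IsFiniteMeasure Q›
  have hP : IsProjectiveLimit P' (fun I : Finset ι => Q'.map I.restrict) := by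
    intro I
    refine Measure.ext_of_singleton fun x => ?_
    rw [Measure.map_apply (by fun_prop) (measurableSet_singleton _),
      Measure.map_apply (by fun_prop) (measurableSet_singleton _)]
    have : (I.restrict ⁻¹' {x} : Set (ι → Prop)) =
        {T : Set ι | ∀ e ∈ I, (e ∈ T ↔ e ∈ {e | ∃ h : e ∈ I, x ⟨e, h⟩})} := by
      ext T
      simp only [Set.mem_preimage, Set.mem_singleton_iff, funext_iff, Finset.restrict]
      constructor
      · intro hT e he
        have := hT ⟨e, he⟩
        change T e ↔ ∃ h : e ∈ I, x ⟨e, h⟩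
        rw [this]
        exact ⟨fun h => ⟨he, h⟩, fun ⟨_, h⟩ => h⟩
      · rintro hT ⟨e, he⟩
        have : T e ↔ ∃ h : e ∈ I, x ⟨e, h⟩ := hT e he
        exact propext (this.trans ⟨fun ⟨_, h⟩ => h, fun h => ⟨he, h⟩⟩)
    rw [this]
    exact h I _
  have hQ : IsProjectiveLimit Q' (fun I : Finset ι => Q'.map I.restrict) := fun I => rfl
  exact hP.unique hQ

/-- If all cylinder probabilities converge, the limits are the cylinder probabilities of a
probability measure. The coding is by `ι → Bool`, since `Set ι`, that is `ι → Prop`, is not a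
Hausdorff space in the product of Mathlib's (Sierpiński) topologies on `Prop`. -/
theorem exists_measure_of_tendsto_cylinder {ι : Type*} [Countable ι] (μ : ℕ → Measure (Set ι))
    [∀ n, IsProbabilityMeasure (μ n)] (c : Finset ι → Set ι → ENNReal)
    (h : ∀ F B, Tendsto (fun n => μ n {T | ∀ e ∈ F, (e ∈ T ↔ e ∈ B)}) atTop (𝓝 (c F B))) :
    ∃ P : Measure (Set ι), IsProbabilityMeasure P ∧
      ∀ F B, P {T | ∀ e ∈ F, (e ∈ T ↔ e ∈ B)} = c F B := by
  classical
  let enc : Set ι → ι → Bool := fun T i => decide (i ∈ T)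
  let dec : (ι → Bool) → Set ι := fun x => {i | x i = true}
  have henc : Measurable enc := by
    refine measurable_pi_iff.2 fun i => ?_
    exact (Measurable.of_discrete (f := fun p : Prop => decide p)).comp (measurable_set_mem i)
  have hdec : Measurable dec := by
    refine measurable_set_iff.2 fun i => ?_
    exact (Measurable.of_discrete (f := fun b : Bool => b = true)).comp (measurable_pi_apply i)
  let ν : ℕ → ProbabilityMeasure (ι → Bool) := fun n =>
    ⟨(μ n).map enc, Measure.isProbabilityMeasure_map henc.aemeasurable⟩
  let U : Ultrafilter ℕ := Ultrafilter.of atTop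
  have hU : (U : Filter ℕ) ≤ atTop := Ultrafilter.of_le atTop
  obtain ⟨ν', -, hν'⟩ := isCompact_univ.ultrafilter_le_nhds' (U.map ν) univ_mem
  have hlim : Tendsto ν U (𝓝 ν') := hν'
  refine ⟨(ν' : Measure (ι → Bool)).map dec,
    Measure.isProbabilityMeasure_map hdec.aemeasurable, fun F B => ?_⟩
  rw [Measure.map_apply hdec (measurableSet_cylinder_prescribed F B)]
  set C : Set (ι → Bool) := dec ⁻¹' {T | ∀ e ∈ F, (e ∈ T ↔ e ∈ B)} with hC
  have hclopen : IsClopen C := by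
    have : C = ⋂ e ∈ F, (fun x : ι → Bool => x e) ⁻¹' {b | b = true ↔ e ∈ B} := by
      ext x; simp [C, dec]
    rw [this]
    exact isClopen_biInter_finset fun e _ => (isClopen_discrete _).preimage (continuous_apply e)
  have h1 := ProbabilityMeasure.tendsto_measure_of_null_frontier_of_tendsto' hlim
    (E := C) (by rw [hclopen.frontier_eq]; simp)
  have h2 : ∀ n, (ν n : Measure (ι → Bool)) C = μ n {T | ∀ e ∈ F, (e ∈ T ↔ e ∈ B)} := by
    intro n
    change (μ n).map enc C = _
    rw [Measure.map_apply henc (hdec (measurableSet_cylinder_prescribed F B))]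
    congr 1
    ext T; simp [enc, dec]
  simp only [h2] at h1
  exact tendsto_nhds_unique h1 ((h F B).mono_left hU)

/-! ### The coefficients and their Fourier series -/

/-- The algebraic relations of `t = γ^(3/2)` and `u = γ^(-3/2)`, all that is used of these numbers.
-/
theorem goldenRatio_rpow_facts :
    ∃ t u : ℝ, Real.goldenRatio ^ (3 / 2 : ℝ) = t ∧ Real.goldenRatio ^ (-(3 / 2) : ℝ) = u ∧
      0 < t ∧ 0 < u ∧ t * u = 1 ∧ t ^ 2 = √5 + 2 ∧ u ^ 2 = √5 - 2 := by
  have hpos := Real.goldenRatio_pos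
  have h5 : √5 * √5 = 5 := Real.mul_self_sqrt (by norm_num)
  have hu : Real.goldenRatio ^ (-(3 / 2) : ℝ) = (Real.goldenRatio ^ (3 / 2 : ℝ))⁻¹ :=
    Real.rpow_neg hpos.le _
  have ht : 0 < Real.goldenRatio ^ (3 / 2 : ℝ) := Real.rpow_pos_of_pos hpos _
  have ht2 : (Real.goldenRatio ^ (3 / 2 : ℝ)) ^ 2 = √5 + 2 := by
    rw [← Real.rpow_natCast, ← Real.rpow_mul hpos.le]
    norm_num
    rw [Real.goldenRatio]
    linear_combination (3 + √5) / 8 * h5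
  refine ⟨_, _, rfl, rfl, ht, by rw [hu]; positivity, by rw [hu]; field_simp, ht2, ?_⟩
  rw [hu, inv_pow, ht2, inv_eq_iff_eq_inv, eq_comm]
  refine inv_eq_of_mul_eq_one_left ?_
  linear_combination h5

/-- The quartic `x⁴ + 2 x³ + 4 x² + 2 x + 1` of the difference equation is the product of this
quadratic and its conjugate. -/
theorem helixAlpha_quadratic : helixAlpha ^ 2 + (1 + Complex.I) * helixAlpha + 1 = 0 := by
  obtain ⟨t, u, ht, hu, -, -, h1, h2, h3⟩ := goldenRatio_rpow_facts
  rw [helixAlpha, ht, hu]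
  have h1' : (t : ℂ) * u = 1 := by exact_mod_cast h1
  have h4 : (t : ℂ) ^ 2 - u ^ 2 = 4 := by
    have : t ^ 2 - u ^ 2 = 4 := by rw [h2, h3]; ring
    exact_mod_cast this
  push_cast
  linear_combination ((t : ℂ) ^ 2 / 4 - 1 / 4 ) * Complex.I_sq + Complex.I / 2 * h1' - h4 / 4

theorem norm_helixAlpha_lt_one : ‖helixAlpha‖ < 1 := by
  obtain ⟨t, u, ht, hu, ht0, hu0, h1, h2, h3⟩ := goldenRatio_rpow_facts
  have h5 : √5 * √5 = 5 := Real.mul_self_sqrt (by norm_num)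
  have h6 : (2 : ℝ) < √5 := by rw [Real.lt_sqrt] <;> norm_num
  have hn : Complex.normSq helixAlpha = ((u - 1) / 2) ^ 2 + ((t - 1) / 2) ^ 2 := by
    rw [helixAlpha, ht, hu, mul_comm, Complex.normSq_add_mul_I]
  have h7 : √5 - 1 < t + u := by
    refine lt_of_pow_lt_pow_left₀ 2 (by positivity) ?_
    nlinarith
  have : ‖helixAlpha‖ ^ 2 < 1 := by
    rw [← Complex.normSq_eq_norm_sq, hn]
    nlinarith
  exact (sq_lt_one_iff₀ (norm_nonneg _)).1 this

theorem helixCoeff_im (m : ℤ) : (helixCoeff m).im = 0 := by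
  rw [helixCoeff, ← map_pow, ← map_mul, Complex.add_im, Complex.conj_im, add_neg_cancel]

/-- The coefficients `helixCoeff`, which are real, as real numbers. -/
def helixCoeffRe (m : ℤ) : ℝ := (helixCoeff m).re

theorem ofReal_helixCoeffRe (m : ℤ) : (helixCoeffRe m : ℂ) = helixCoeff m :=
  Complex.ext rfl (by simp [helixCoeff_im])

theorem helixCoeffRe_natCast (k : ℕ) :
    helixCoeffRe k = 2 * (helixEta * helixAlpha ^ k).re := by
  rw [helixCoeffRe, helixCoeff, ← map_pow, ← map_mul, Complex.add_re, Complex.conj_re,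
    Int.natAbs_natCast, two_mul]

theorem helixCoeffRe_neg (m : ℤ) : helixCoeffRe (-m) = helixCoeffRe m := by
  simp only [helixCoeffRe, helixCoeff, Int.natAbs_neg]

/-- The difference equation of the coefficients at `0` and at `1`, where it involves coefficients
with negative index and so the absolute value in the exponent. -/
theorem helixEta_mul_re :
    (helixEta * (4 + 4 * helixAlpha + 2 * helixAlpha ^ 2)).re = 1 / 2 ∧
    (helixEta * (2 + 5 * helixAlpha + 2 * helixAlpha ^ 2 + helixAlpha ^ 3)).re = 0 := by
  have hq := helixAlpha_quadratic
  have e1 : 4 + 4 * helixAlpha + 2 * helixAlpha ^ 2 = 2 + 2 * (1 - Complex.I) * helixAlpha := by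
    linear_combination 2 * hq
  have e2 : 2 + 5 * helixAlpha + 2 * helixAlpha ^ 2 + helixAlpha ^ 3 =
      1 + Complex.I + 2 * helixAlpha := by
    linear_combination (helixAlpha + 1 - Complex.I) * hq + helixAlpha * Complex.I_sq
  rw [e1, e2]
  obtain ⟨t, u, ht, hu, ht0, hu0, h1, h2, h3⟩ := goldenRatio_rpow_facts
  have hA : helixAlpha = ⟨(u - 1) / 2, (t - 1) / 2⟩ := by
    rw [Complex.mk_eq_add_mul_I, helixAlpha, ht, hu, mul_comm Complex.I]
  have hE : helixEta = ⟨t / (4 * √5), u / (4 * √5)⟩ := by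
    rw [Complex.mk_eq_add_mul_I, helixEta, ht, hu, mul_comm Complex.I]
  rw [hA, hE]
  have h6 : (0 : ℝ) < √5 := by positivity
  constructor
  · simp
    field_simp
    linear_combination 2 * h2 + 2 * h3
  · simp
    field_simp
    ring

/-- The coefficients solve `A g = δ₀` for the Toeplitz matrix `A` with rows `1, 2, 4, 2, 1`. -/
theorem helixCoeffRe_recurrence (m : ℤ) :
    4 * helixCoeffRe m + 2 * helixCoeffRe (m - 1) + 2 * helixCoeffRe (m + 1) +
      helixCoeffRe (m - 2) + helixCoeffRe (m + 2) = if m = 0 then 1 else 0 := by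
  wlog hm : 0 ≤ m generalizing m
  · have := this (-m) (by omega)
    simp only [neg_eq_zero] at this
    rw [← this, ← helixCoeffRe_neg m, ← helixCoeffRe_neg (m - 1), ← helixCoeffRe_neg (m + 1),
      ← helixCoeffRe_neg (m - 2), ← helixCoeffRe_neg (m + 2)]
    ring_nf
  lift m to ℕ using hm
  have e : ∀ k : ℕ, helixCoeffRe k = 2 * (helixEta * helixAlpha ^ k).re := helixCoeffRe_natCast
  rcases m with _ | _ | k
  · have h1 := helixCoeffRe_neg 1
    have h2 := helixCoeffRe_neg 2
    have e0 := e 0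
    have e1 := e 1
    have e2 := e 2
    have h := helixEta_mul_re.1
    have : helixEta * (4 + 4 * helixAlpha + 2 * helixAlpha ^ 2) =
      ((4 : ℝ) : ℂ) * (helixEta * helixAlpha ^ 0) + ((4 : ℝ) : ℂ) * (helixEta * helixAlpha ^ 1) +
        ((2 : ℝ) : ℂ) * (helixEta * helixAlpha ^ 2) := by push_cast; ring
    rw [this, Complex.add_re, Complex.add_re, Complex.re_ofReal_mul, Complex.re_ofReal_mul,
      Complex.re_ofReal_mul] at h
    norm_num at *
    linarith
  · have h1 := helixCoeffRe_neg 1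
    have e0 := e 0
    have e1 := e 1
    have e2 := e 2
    have e3 := e 3
    have h := helixEta_mul_re.2
    have : helixEta * (2 + 5 * helixAlpha + 2 * helixAlpha ^ 2 + helixAlpha ^ 3) =
      ((2 : ℝ) : ℂ) * (helixEta * helixAlpha ^ 0) + ((5 : ℝ) : ℂ) * (helixEta * helixAlpha ^ 1) +
        ((2 : ℝ) : ℂ) * (helixEta * helixAlpha ^ 2) + helixEta * helixAlpha ^ 3 := by
      push_cast; ring
    rw [this, Complex.add_re, Complex.add_re, Complex.add_re, Complex.re_ofReal_mul,
      Complex.re_ofReal_mul, Complex.re_ofReal_mul] at h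
    norm_num at *
    linarith
  · have h : helixEta * helixAlpha ^ k + ((2 : ℝ) : ℂ) * (helixEta * helixAlpha ^ (k + 1)) +
        ((4 : ℝ) : ℂ) * (helixEta * helixAlpha ^ (k + 2)) +
        ((2 : ℝ) : ℂ) * (helixEta * helixAlpha ^ (k + 3)) +
        helixEta * helixAlpha ^ (k + 4) = 0 := by
      push_cast
      linear_combination helixEta * helixAlpha ^ k *
        (helixAlpha ^ 2 + (1 - Complex.I) * helixAlpha + 1) * helixAlpha_quadratic +
        helixEta * helixAlpha ^ k * helixAlpha ^ 2 * Complex.I_sq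
    have h := congrArg Complex.re h
    simp only [Complex.add_re, Complex.re_ofReal_mul, Complex.zero_re] at h
    rw [if_neg (by omega)]
    have e0 := e k
    have e1 := e (k + 1)
    have e2 := e (k + 2)
    have e3 := e (k + 3)
    have e4 := e (k + 4)
    push_cast at *
    rw [show (k : ℤ) + 1 + 1 - 1 = k + 1 by ring, show (k : ℤ) + 1 + 1 - 2 = k by ring,
      show (k : ℤ) + 1 + 1 + 1 = k + 3 by ring, show (k : ℤ) + 1 + 1 + 2 = k + 4 by ring,
      show (k : ℤ) + 1 + 1 = k + 2 by ring]
    linarith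

theorem summable_abs_helixCoeffRe : Summable fun m : ℤ => |helixCoeffRe m| := by
  have h : Summable fun k : ℕ => |helixCoeffRe k| := by
    refine Summable.of_nonneg_of_le (fun _ => abs_nonneg _) (fun k => ?_)
      ((summable_geometric_of_lt_one (norm_nonneg _) norm_helixAlpha_lt_one).mul_left
        (2 * ‖helixEta‖))
    rw [helixCoeffRe_natCast, abs_mul, abs_two, mul_assoc, ← norm_pow, ← norm_mul]
    exact mul_le_mul_of_nonneg_left (Complex.abs_re_le_norm _) zero_le_two
  exact Summable.of_nat_of_neg h (by simpa only [helixCoeffRe_neg] using h)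

theorem isHelixGreen_helixCoeffRe : IsHelixGreen helixCoeffRe := by
  refine ⟨helixCoeffRe_neg, helixCoeffRe_recurrence, ?_⟩
  have := summable_abs_helixCoeffRe.tendsto_cofinite_zero
  rw [Int.cofinite_eq, tendsto_sup] at this
  exact (tendsto_zero_iff_abs_tendsto_zero _).2 this.2

theorem helix_denominator (x : ℝ) :
    4 + 4 * Real.cos (2 * Real.pi * x) + 2 * Real.cos (4 * Real.pi * x) =
      1 + (1 + 2 * Real.cos (2 * Real.pi * x)) ^ 2 := by
  rw [show 4 * Real.pi * x = 2 * (2 * Real.pi * x) by ring, Real.cos_two_mul]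
  ring

/-- Let `S` be the sum of the series, and let `z = exp (2 π i x)`. Shifting the index by `c`
multiplies the sum by `z ^ (-c)`, so the difference equation gives `(4 + 2 z + 2 z⁻¹ + z² + z⁻²) S =
1`. -/
theorem hasSum_helixCoeff (x : ℝ) :
    HasSum (fun k : ℤ => helixCoeff k * Complex.exp (2 * Real.pi * Complex.I * k * x))
      ((1 / (4 + 4 * Real.cos (2 * Real.pi * x) + 2 * Real.cos (4 * Real.pi * x)) : ℝ) : ℂ) := by
  set z := Complex.exp (2 * Real.pi * Complex.I * x) with hz
  have hexp : ∀ k : ℤ, Complex.exp (2 * Real.pi * Complex.I * k * x) = z ^ k := by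
    intro k
    rw [hz, ← Complex.exp_int_mul]
    congr 1; ring
  have hz0 : z ≠ 0 := Complex.exp_ne_zero _
  have hzn : ‖z‖ = 1 := by
    rw [hz, show (2 * Real.pi * Complex.I * x : ℂ) = ((2 * Real.pi * x : ℝ) : ℂ) * Complex.I by
      push_cast; ring, Complex.norm_exp_ofReal_mul_I]
  simp only [hexp, ← ofReal_helixCoeffRe]
  have hsum : Summable fun k : ℤ => (helixCoeffRe k : ℂ) * z ^ k := by
    refine Summable.of_norm ?_
    simpa [hzn] using summable_abs_helixCoeffRe
  obtain ⟨S, hS⟩ := hsum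
  have hshift : ∀ c : ℤ, HasSum (fun k : ℤ => (helixCoeffRe (k + c) : ℂ) * z ^ k)
      (z ^ (-c) * S) := by
    intro c
    have := ((Equiv.addRight c).hasSum_iff.2 hS).mul_left (z ^ (-c))
    refine this.congr_fun fun k => ?_
    simp only [Function.comp_apply, Equiv.coe_addRight]
    rw [zpow_add₀ hz0, zpow_neg]
    field_simp
  have htot := ((((hS.mul_left 4).add ((hshift (-1)).mul_left 2)).add
    ((hshift 1).mul_left 2)).add (hshift (-2))).add (hshift 2)
  have hone : HasSum (fun k : ℤ => if k = 0 then (1 : ℂ) else 0) 1 := hasSum_ite_eq 0 1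
  have heq := (htot.congr_fun (g := fun k : ℤ => if k = 0 then (1 : ℂ) else 0) ?_).unique hone
  · have hcos : (2 * Real.cos (2 * Real.pi * x) : ℂ) = z + z⁻¹ := by
      rw [hz, ← Complex.exp_neg, Complex.ofReal_cos, Complex.two_cos]
      push_cast
      ring_nf
    have hS' : S * (1 + (1 + 2 * Real.cos (2 * Real.pi * x)) ^ 2 : ℂ) = 1 := by
      refine Eq.trans ?_ heq
      rw [hcos]
      simp only [neg_neg, zpow_neg, zpow_ofNat]
      field_simp
      ring
    have hne : (1 + (1 + 2 * Real.cos (2 * Real.pi * x)) ^ 2 : ℂ) ≠ 0 := by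
      intro h0; rw [h0, mul_zero] at hS'; exact zero_ne_one hS'
    rw [helix_denominator]
    convert hS using 1
    push_cast at hne hS' ⊢
    rw [eq_comm, eq_div_iff hne]
    exact hS'
  · intro k
    have h := helixCoeffRe_recurrence k
    have h' : (4 * helixCoeffRe k + 2 * helixCoeffRe (k - 1) + 2 * helixCoeffRe (k + 1) +
      helixCoeffRe (k - 2) + helixCoeffRe (k + 2) : ℂ) = if k = 0 then 1 else 0 := by
      split_ifs at h ⊢ <;> exact_mod_cast h
    have h2 : (if k = 0 then (1 : ℂ) else 0) = (if k = 0 then (1 : ℂ) else 0) * z ^ k := by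
      split_ifs with hk
      · simp [hk]
      · simp
    rw [h2, ← h']
    simp only [← sub_eq_add_neg]
    ring

theorem integral_exp_two_pi_mul (m : ℤ) :
    ∫ x in Set.Icc (0 : ℝ) 1, Complex.exp (2 * Real.pi * Complex.I * m * x) =
      if m = 0 then 1 else 0 := by
  rw [integral_Icc_eq_integral_Ioc, ← intervalIntegral.integral_of_le zero_le_one]
  split_ifs with hm
  · simp [hm]
  · have hc : (2 * Real.pi * Complex.I * m : ℂ) ≠ 0 := by
      simp [hm, Real.pi_ne_zero]
    rw [integral_exp_mul_complex hc]
    have : Complex.exp (2 * Real.pi * Complex.I * m) = 1 := by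
      rw [Complex.exp_eq_one_iff]
      exact ⟨m, by ring⟩
    simp [this]

/-- The coefficient formula follows from the absolutely convergent series by termwise integration.
-/
theorem isFourierTransform_helixCoeff :
    IsFourierTransform helixCoeff
      (fun x : ℝ => 1 / (4 + 4 * Real.cos (2 * Real.pi * x) + 2 * Real.cos (4 * Real.pi * x))) := by
  refine ⟨by fun_prop, fun x _ => ?_, fun k => ?_, fun x _ => hasSum_helixCoeff x⟩
  · beta_reduce
    rw [helix_denominator]
    have : 0 ≤ (1 + 2 * Real.cos (2 * Real.pi * x)) ^ 2 := sq_nonneg _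
    exact ⟨by positivity, div_le_one_of_le₀ (by linarith) (by positivity)⟩
  · let F : ℤ → ℝ → ℂ := fun j x =>
      helixCoeff j * Complex.exp (2 * Real.pi * Complex.I * ((j - k : ℤ) : ℂ) * x)
    have hF : ∀ x : ℝ, HasSum (fun j => F j x)
        (((1 / (4 + 4 * Real.cos (2 * Real.pi * x) + 2 * Real.cos (4 * Real.pi * x)) : ℝ) : ℂ) *
          Complex.exp (-(2 * Real.pi * Complex.I * k * x))) := by
      intro x
      refine ((hasSum_helixCoeff x).mul_right _).congr_fun fun j => ?_
      simp only [F]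
      rw [mul_assoc (helixCoeff j), ← Complex.exp_add]
      congr 2
      push_cast; ring
    have hnorm : ∀ j x, ‖F j x‖ = |helixCoeffRe j| := by
      intro j x
      rw [norm_mul, show (2 * Real.pi * Complex.I * ((j - k : ℤ) : ℂ) * x : ℂ) =
        ((2 * Real.pi * ((j - k : ℤ) : ℝ) * x : ℝ) : ℂ) * Complex.I by push_cast; ring,
        Complex.norm_exp_ofReal_mul_I, mul_one, ← ofReal_helixCoeffRe, Complex.norm_real,
        Real.norm_eq_abs]
    have hint := hasSum_integral_of_summable_integral_norm (F := F)
      (μ := volume.restrict (Set.Icc (0 : ℝ) 1)) (fun j => ?_) ?_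
    · simp only [fun x => (hF x).tsum_eq] at hint
      refine (hasSum_ite_eq k (helixCoeff k)).unique (hint.congr_fun fun j => ?_)
      simp only [F]
      rw [integral_const_mul, integral_exp_two_pi_mul]
      by_cases hj : j = k
      · simp [hj]
      · simp [hj, sub_eq_zero]
    · have : Continuous (F j) := by simp only [F]; fun_prop
      exact this.continuousOn.integrableOn_Icc
    · simp only [hnorm]
      simpa using summable_abs_helixCoeffRe

/-! ### The spanning tree measure and its rung process -/

theorem measure_cylinder_of_isHelixUST {P : Measure (Set (Sym2 ℤ))} (hP : IsHelixUST 3 P)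
    (F : Finset (Sym2 ℤ)) (B : Set (Sym2 ℤ)) :
    P {T | ∀ e ∈ F, (e ∈ T ↔ e ∈ B)} = ENNReal.ofReal
      (cylinderMatrix F B (Matrix.of fun e f : F => helixKernel helixCoeffRe e f)).det :=
  tendsto_nhds_unique (hP.2 F B) (tendsto_uniformOn_helix isHelixGreen_helixCoeffRe F B)

theorem existsUnique_isHelixUST : ∃! P : Measure (Set (Sym2 ℤ)), IsHelixUST 3 P := by
  have hprob : ∀ n : ℕ, IsProbabilityMeasure
      (uniformOn (spanningTrees (helixGraph 3) (Set.Icc (-(n : ℤ)) (n : ℤ)))) := by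
    intro n
    refine ⟨?_⟩
    have := uniformOn_spanningTrees_cylinder (a := -(n : ℤ)) (b := n) (by omega) _ _
      (mem_helixEdges n) (det_helixGram_ne_zero n) ∅ ∅
    simpa using this
  obtain ⟨P, hP1, hP2⟩ := exists_measure_of_tendsto_cylinder _ _
    (tendsto_uniformOn_helix isHelixGreen_helixCoeffRe)
  refine ⟨P, ⟨hP1, fun F B => ?_⟩, fun Q hQ => ?_⟩
  · rw [hP2]
    exact tendsto_uniformOn_helix isHelixGreen_helixCoeffRe F B
  · have := hQ.1
    exact measure_ext_of_cylinder fun F B => by rw [hP2, measure_cylinder_of_isHelixUST hQ]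

theorem helixKernel_rung (g : ℤ → ℝ) (k l : ℤ) : helixKernel g (rung k) (rung l) = g (k - l) := by
  have h : ∀ m : ℤ, rung m ∈ (helixGraph 3).edgeSet := fun m =>
    (mem_edgeSet_helixGraph _).2 ⟨m, Or.inl rfl⟩
  have hI : ∀ m : ℤ, Finset.Ioc (m - 1) m = {m} := fun m => by ext; simp; omega
  rw [helixKernel, if_pos ⟨h k, h l⟩, (rung_inf_sup k).1, (rung_inf_sup k).2,
    (rung_inf_sup l).1, (rung_inf_sup l).2, hI, hI, Finset.sum_singleton, Finset.sum_singleton]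

theorem rung_injective : Function.Injective rung := fun x y h => by
  rw [← (rung_inf_sup x).2, h, (rung_inf_sup y).2]

theorem measureReal_rungs_of_isHelixUST {P : Measure (Set (Sym2 ℤ))} (hP : IsHelixUST 3 P)
    (S : Finset ℤ) :
    P.real {T | ∀ s ∈ S, rung s ∈ T} =
      (Matrix.of fun k l : S => helixCoeffRe ((l : ℤ) - k)).det := by
  have hev : {T : Set (Sym2 ℤ) | ∀ s ∈ S, rung s ∈ T} =
      {T | ∀ e ∈ S.image rung, (e ∈ T ↔ e ∈ (Set.univ : Set (Sym2 ℤ)))} := by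
    ext T; simp
  rw [hev, Measure.real, measure_cylinder_of_isHelixUST hP, ENNReal.toReal_ofReal
    (det_cylinderMatrix_helixKernel_nonneg isHelixGreen_helixCoeffRe _ _)]
  let ψ : S ≃ (S.image rung : Finset (Sym2 ℤ)) :=
    Equiv.ofBijective (fun s => ⟨rung s, Finset.mem_image_of_mem _ s.2⟩)
      ⟨fun x y h => Subtype.ext (rung_injective (Subtype.ext_iff.1 h)), fun ⟨e, he⟩ => by
        obtain ⟨s, hs, rfl⟩ := Finset.mem_image.1 he
        exact ⟨⟨s, hs⟩, rfl⟩⟩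
  rw [← Matrix.det_submatrix_equiv_self ψ]
  congr 1
  ext k l
  simp only [Matrix.submatrix_apply, cylinderMatrix, Matrix.of_apply, Set.mem_univ, if_true]
  change helixKernel helixCoeffRe (rung k) (rung l) = _
  rw [helixKernel_rung, ← helixCoeffRe_neg, neg_sub]

theorem rungProcess_eq_one_iff (m : ℤ) (T : Set (Sym2 ℤ)) : rungProcess m T = 1 ↔ rung m ∈ T := by
  classical
  simp [rungProcess, Set.indicator_apply]

theorem isDeterminantalProcess_rungProcess {P : Measure (Set (Sym2 ℤ))} (hP : IsHelixUST 3 P) :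
    IsDeterminantalProcess P rungProcess (toeplitz helixCoeff) := by
  classical
  refine ⟨fun s => ?_, fun s T => ?_, ?_, fun S => ?_⟩
  · have : rungProcess s = fun T : Set (Sym2 ℤ) =>
        Set.indicator {T : Set (Sym2 ℤ) | rung s ∈ T} (fun _ => 1) T := by
      ext T; simp [rungProcess, Set.indicator_apply]
    rw [this]
    exact measurable_const.indicator (measurableSet_mem _)
  · simp only [rungProcess, Set.indicator_apply]
    split_ifs <;> simp
  · ext k l
    simp only [Matrix.conjTranspose_apply, toeplitz, Matrix.of_apply, ← ofReal_helixCoeffRe]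
    rw [RCLike.star_def, Complex.conj_ofReal, ← helixCoeffRe_neg, neg_sub]
  · simp only [rungProcess_eq_one_iff]
    rw [measureReal_rungs_of_isHelixUST hP, ← Complex.ofRealHom_eq_coe, RingHom.map_det]
    congr 1
    ext k l
    simp [toeplitz, ofReal_helixCoeffRe]

theorem theorem3 :
    (∃! P : Measure (Set (Sym2 ℤ)), IsHelixUST 3 P) ∧
    (∀ P : Measure (Set (Sym2 ℤ)), IsHelixUST 3 P →
      IsDeterminantalProcess P rungProcess (toeplitz helixCoeff)) ∧
    (∀ k l : ℤ, (toeplitz helixCoeff k l).im = 0) ∧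
    IsFourierTransform helixCoeff
      (fun x : ℝ => 1 / (4 + 4 * Real.cos (2 * Real.pi * x) + 2 * Real.cos (4 * Real.pi * x))) :=
  ⟨existsUnique_isHelixUST, fun _ hP => isDeterminantalProcess_rungProcess hP,
    fun _ _ => helixCoeff_im _, isFourierTransform_helixCoeff⟩

end
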